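/- Let $P$ be a $d$-polytope (a $d$-dimensional convex polytope in some $\mathbb{R}^n$) with exactly $d+4$ vertices and at least $d+4$ facets. The extension complexity $\mathrm{xc}(P)$ is the minimal number of facets of a polytope $Q$ that can be mapped onto $P$ by an affine map. Then $\mathrm{xc}(P)=d+3$ if and only if at least one of the following holds: 1. $P$ is a $(d-2)$-fold pyramid over a Desarguian hexagon; 2. there is a set of $6$ vertices of $P$ whose convex hull is a triangular prism. Here a $k$-fold pyramid over $H$ is obtained from $H$ by taking $k$ times in succession the convex hull with a point outside the current affine hull. A hexagon is Desarguian if its vertices can be labeled cyclically $p_0,\dots,p_5$ in such a way that the lines $p_0p_1$, $p_5p_2$ and $p_3p_4$ are concurrent in the projective sense, that is, they have a common point or are all parallel. A triangular prism is any polytope combinatorially equivalent to the product $\Delta_1\times\Delta_2$ of a segment and a triangle, that is, with isomorphic face lattice. -/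

import Mathlib

namespace PolyXC

/-! Polytopes in real topological vector spaces, their faces, vertices, facets. -/

section Defs

variable {E F : Type*}
  [AddCommGroup E] [Module ℝ E] [TopologicalSpace E]
  [AddCommGroup F] [Module ℝ F] [TopologicalSpace F]

/-- A polytope is the convex hull of a finite set of points. -/
def IsPolytope (P : Set E) : Prop :=
  ∃ S : Set E, S.Finite ∧ P = convexHull ℝ S

/-- The dimension of a nonempty convex set: the dimension of the linear space
parallel to its affine hull. -/
noncomputable def dim (P : Set E) : ℕ :=
  Module.finrank ℝ (vectorSpan ℝ P)

/-- The faces of a polytope `P`: the empty set, and the sets of maximizers over `P` of linear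
functionals (the zero functional gives `P` itself). -/
def faces (P : Set E) : Set (Set E) :=
  {G | IsExposed ℝ P G}

/-- The vertices of a polytope. -/
def vertices (P : Set E) : Set E :=
  P.extremePoints ℝ

/-- The facets of `P`: the nonempty faces of dimension `dim P - 1`. -/
def facets (P : Set E) : Set (Set E) :=
  {G | G ∈ faces P ∧ G.Nonempty ∧ dim G + 1 = dim P}

/-- Two polytopes are combinatorially equivalent if their face lattices (the sets of all their
faces, ordered by inclusion) are isomorphic. -/
def CombEquiv (P : Set E) (Q : Set F) : Prop :=
  Nonempty (faces P ≃o faces Q)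

/-- The extension complexity of `P`: the least number of facets of a polytope `Q`, in a Euclidean
space of arbitrary dimension, of which `P` is the image under an affine map. -/
noncomputable def xc (P : Set E) : ℕ :=
  sInf {k : ℕ | ∃ (m : ℕ) (Q : Set (EuclideanSpace ℝ (Fin m)))
    (π : EuclideanSpace ℝ (Fin m) →ᵃ[ℝ] E),
    IsPolytope Q ∧ π '' Q = P ∧ (facets Q).ncard = k}

/-- `IsPyramid k B P`: the set `P` is a `k`-fold pyramid over `B`, that is, `P` arises from `B` by
taking `k` times in succession the convex hull with a point (an apex) outside the affine hull. -/
def IsPyramid : ℕ → Set E → Set E → Prop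
  | 0, B, P => P = B
  | k + 1, B, P => ∃ (R : Set E) (a : E), IsPyramid k B R ∧ a ∉ affineSpan ℝ R ∧
      P = convexHull ℝ (insert a R)

/-- A triangular prism: a polytope combinatorially equivalent to the product of a segment
(a 1-simplex) and a triangle (a 2-simplex). -/
def IsTriangularPrism (P : Set E) : Prop :=
  IsPolytope P ∧ CombEquiv P (stdSimplex ℝ (Fin 2) ×ˢ stdSimplex ℝ (Fin 3))

/-- Three lines are concurrent, in the projective sense, if they have a common point or are all
parallel (have a common point at infinity). -/
def ConcurrentLines (L₁ L₂ L₃ : AffineSubspace ℝ E) : Prop :=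
  (∃ x, x ∈ L₁ ∧ x ∈ L₂ ∧ x ∈ L₃) ∨ (L₁.Parallel L₂ ∧ L₂.Parallel L₃)

/-- A hexagon: a two-dimensional polytope with six vertices. -/
def IsHexagon (H : Set E) : Prop :=
  IsPolytope H ∧ dim H = 2 ∧ (vertices H).ncard = 6

/-- A cyclic labeling of the vertices of a hexagon: a bijective labeling by `Fin 6` for which
cyclically consecutive vertices (`i + 1` is computed modulo 6) span edges. -/
def IsCyclicLabeling (H : Set E) (p : Fin 6 → E) : Prop :=
  Function.Injective p ∧ Set.range p = vertices H ∧
    ∀ i : Fin 6, segment ℝ (p i) (p (i + 1)) ∈ faces H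

/-- A hexagon is Desarguian if, for some cyclic labeling `p 0, …, p 5` of its vertices, the three
lines `p 0 p 1`, `p 5 p 2` and `p 3 p 4` are concurrent. -/
def IsDesarguianHexagon (H : Set E) : Prop :=
  IsHexagon H ∧ ∃ p : Fin 6 → E, IsCyclicLabeling H p ∧
    ConcurrentLines (affineSpan ℝ {p 0, p 1}) (affineSpan ℝ {p 5, p 2})
      (affineSpan ℝ {p 3, p 4})

end Defs

end PolyXC

set_option linter.unusedSectionVars false

/-! Write k for the extension complexity. Points x become vectors (x, 1), so affine functions become
linear functionals, and the facets of a polytope that is not a point are a minimal supply of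
generators for the functionals nonnegative on it (`generated_facets`, `Generated.facets_le`).

Sufficiency. Adding one point to a polytope costs at most one facet of an extension: take a pyramid
over the extension (`xc_insert_le`). A triangular prism has five facets. A Desarguian hexagon is a
projection of a projectively transformed prism: the common point of the three lines is the image of
the common point of the three edge lines joining the two triangles (`IsDesarguianHexagon.xc_le`). So
both kinds of polytope satisfy xc ≤ d + 3; the reverse inequality comes with the analysis below.

Necessity. Let Q be an extension with k facets. Its facet slacks embed the cone over Q as the
intersection of the orthant of ℝ^k with a subspace L, and the cone over P is the image of this
intersection under a linear map (`exists_isSlackRep`). If L were everything, P would have at most k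
vertices; if the map were injective on L, P would have at most k facets. When P has more than k of
each, L has codimension at least 1 and the kernel has dimension at least 1, so k ≥ d + 3. Equality
forces L to be a hyperplane orthogonal to a vector w and the kernel to be a line spanned by a vector
r with w · r = 0 (`IsSlackRep.isProjection_or`).

The nonnegative vectors orthogonal to w are generated by the unit vectors at the zeros of w and by
one vector for each pair of a positive and a negative coordinate (`exists_combination`); for r the
same description bounds the facets. With z zeros, p positive and q negative entries there are z + pq
generators and k = z + p + q. Having at least k + 1 facets makes r so rich in signs that at most one
generator for w fails to give a vertex of its own (`not_survives_unique`). Hence k + 1 ≤ z + pq ≤ k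
+ 2, which leaves {p, q} = {2, 3} or {2, 4} (`product_cases`).

For {2, 4} exactly one generator is lost; dropping a coordinate in its support leaves a 2 × 3 array
of vertices, a prism. For {2, 3} all generators give distinct vertices. If r is nonzero at some zero
of w, the projection is injective on the span of the 2 × 3 array, again a prism. Otherwise the zeros
of w give the apexes of a (d − 2)-fold pyramid, and the signs of r on the five other coordinates
show that the base is a Desarguian hexagon (`hexagon_signs`, `IsGenPoints.concurrent`). -/

namespace PolyXC

/-! ### Homogenization, and faces as zero sets of nonnegative functionals -/

section Homogenization

variable {E F : Type*} [NormedAddCommGroup E] [NormedSpace ℝ E]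
  [NormedAddCommGroup F] [NormedSpace ℝ F]

/-- The homogenization of a point. -/
def hom (x : E) : E × ℝ := (x, 1)

/-- The linear span of the homogenized points of a set. -/
def homSpan (P : Set E) : Submodule ℝ (E × ℝ) := Submodule.span ℝ (hom '' P)

/-- A homogenized affine function that is nonnegative on `P`. -/
def NonnegOn (f : E × ℝ →ₗ[ℝ] ℝ) (P : Set E) : Prop := ∀ x ∈ P, 0 ≤ f (hom x)

/-- The affine functions that are nonnegative on `P` are, on `P`, the nonnegative combinations
of a family indexed by `ι`. -/
def Generated (P : Set E) (ι : Type*) [Fintype ι] : Prop :=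
  ∃ l : ι → (E × ℝ →ₗ[ℝ] ℝ), (∀ i, NonnegOn (l i) P) ∧ ∀ f, NonnegOn f P →
    ∃ c : ι → ℝ, (∀ i, 0 ≤ c i) ∧ ∀ x ∈ P, f (hom x) = ∑ i, c i * l i (hom x)

/-- The homogenization of an affine map. -/
def homMap (π : E →ᵃ[ℝ] F) : E × ℝ →ₗ[ℝ] F × ℝ :=
  ((π.linear.comp (LinearMap.fst ℝ E ℝ)) +
    (LinearMap.toSpanSingleton ℝ F (π 0)).comp (LinearMap.snd ℝ E ℝ)).prod (LinearMap.snd ℝ E ℝ)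

@[simp] theorem homMap_hom (π : E →ᵃ[ℝ] F) (x : E) : homMap π (hom x) = hom (π x) := by
  have := π.linearMap_vsub x 0
  simp only [vsub_eq_sub, sub_zero] at this
  simp [homMap, hom, this]

@[simp] theorem hom_fst (x : E) : (hom x).1 = x := rfl

@[simp] theorem hom_snd (x : E) : (hom x).2 = 1 := rfl

theorem hom_injective : Function.Injective (hom : E → E × ℝ) := fun _ _ h => congrArg Prod.fst h

theorem hom_combo {a b : ℝ} (h : a + b = 1) (x y : E) :
    hom (a • x + b • y) = a • hom x + b • hom y := by
  ext <;> simp [hom, h]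

theorem hom_mem_homSpan {P : Set E} {x : E} (hx : x ∈ P) : hom x ∈ homSpan P :=
  Submodule.subset_span ⟨x, hx, rfl⟩

theorem homSpan_mono {P Q : Set E} (h : P ⊆ Q) : homSpan P ≤ homSpan Q :=
  Submodule.span_mono (Set.image_mono h)

theorem hom_mem_convexHull {S : Set E} {x : E} (K : Set (E × ℝ)) (hK : Convex ℝ K)
    (hS : ∀ s ∈ S, hom s ∈ K) (hx : x ∈ convexHull ℝ S) : hom x ∈ K := by
  have : convexHull ℝ S ⊆ {y | hom y ∈ K} := by
    refine convexHull_min hS ?_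
    intro y hy z hz a b ha hb hab
    simp only [Set.mem_ofPred_eq, hom_combo hab] at *
    exact hK hy hz ha hb hab
  exact this hx

theorem homSpan_convexHull (S : Set E) : homSpan (convexHull ℝ S) = homSpan S := by
  refine le_antisymm ?_ (homSpan_mono (subset_convexHull ℝ S))
  refine Submodule.span_le.2 ?_
  rintro _ ⟨x, hx, rfl⟩
  exact hom_mem_convexHull _ (homSpan S).convex (fun s hs => hom_mem_homSpan hs) hx

theorem NonnegOn.convexHull {S : Set E} {f : E × ℝ →ₗ[ℝ] ℝ} (h : NonnegOn f S) :
    NonnegOn f (convexHull ℝ S) := fun _ hx =>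
  hom_mem_convexHull {v | 0 ≤ f v} (convex_halfSpace_ge f.isLinear 0) h hx

theorem eq_on_homSpan {P : Set E} {f g : E × ℝ →ₗ[ℝ] ℝ} (h : ∀ x ∈ P, f (hom x) = g (hom x))
    {v : E × ℝ} (hv : v ∈ homSpan P) : f v = g v := by
  have : homSpan P ≤ LinearMap.eqLocus f g := by
    refine Submodule.span_le.2 ?_
    rintro _ ⟨x, hx, rfl⟩
    exact h x hx
  exact this hv

theorem eq_on_convexHull {S : Set E} {f g : E × ℝ →ₗ[ℝ] ℝ}
    (h : ∀ x ∈ S, f (hom x) = g (hom x)) {x : E} (hx : x ∈ convexHull ℝ S) :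
    f (hom x) = g (hom x) :=
  eq_on_homSpan h (homSpan_convexHull S ▸ hom_mem_homSpan hx)

theorem zeros_convexHull {S : Set E} {f : E × ℝ →ₗ[ℝ] ℝ} (h : NonnegOn f S) :
    {x ∈ convexHull ℝ S | f (hom x) = 0} = convexHull ℝ {x ∈ S | f (hom x) = 0} := by
  apply Set.Subset.antisymm
  · have : convexHull ℝ S ⊆ {x | x ∈ convexHull ℝ S ∧
        (0 < f (hom x) ∨ x ∈ convexHull ℝ {x ∈ S | f (hom x) = 0})} := by
      refine convexHull_min ?_ ?_
      · intro s hs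
        refine ⟨subset_convexHull _ _ hs, ?_⟩
        rcases (h s hs).lt_or_eq with h1 | h1
        · exact Or.inl h1
        · exact Or.inr (subset_convexHull _ _ ⟨hs, h1.symm⟩)
      · rintro x ⟨hx, hx'⟩ y ⟨hy, hy'⟩ a b ha hb hab
        refine ⟨convex_convexHull ℝ S hx hy ha hb hab, ?_⟩
        rcases ha.eq_or_lt with rfl | ha
        · obtain rfl : b = 1 := by linarith
          simpa using hy'
        rcases hb.eq_or_lt with rfl | hb
        · obtain rfl : a = 1 := by linarith
          simpa using hx'
        have h1 := h.convexHull x hx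
        have h2 := h.convexHull y hy
        rw [hom_combo hab, map_add, map_smul, map_smul, smul_eq_mul, smul_eq_mul]
        rcases hx' with hx' | hx'
        · left; positivity
        rcases hy' with hy' | hy'
        · left; positivity
        right
        exact convex_convexHull ℝ _ hx' hy' ha.le hb.le hab
    rintro x ⟨hx, hx0⟩
    rcases (this hx).2 with h1 | h1
    · exact absurd hx0 h1.ne'
    · exact h1
  · intro x hx
    refine ⟨convexHull_mono (Set.sep_subset _ _) hx, ?_⟩
    exact eq_on_convexHull (g := 0) (fun y hy => by simpa using hy.2) hx

/-- The height functional maps the span onto ℝ, and its kernel there is the direction space of the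
affine hull; this gives the extra 1. -/
theorem finrank_homSpan [FiniteDimensional ℝ E] {P : Set E} (hP : P.Nonempty) :
    Module.finrank ℝ (homSpan P) = dim P + 1 := by
  obtain ⟨x₀, hx₀⟩ := hP
  set g := (LinearMap.snd ℝ E ℝ).domRestrict (homSpan P) with hg
  have h1 := LinearMap.finrank_range_add_finrank_ker g
  have hr : LinearMap.range g = ⊤ := by
    rw [LinearMap.range_eq_top]
    intro t
    exact ⟨t • ⟨hom x₀, hom_mem_homSpan hx₀⟩, by simp [hg]⟩
  have hk : (LinearMap.ker g).map (homSpan P).subtype =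
      (vectorSpan ℝ P).map (LinearMap.inl ℝ E ℝ) := by
    apply le_antisymm
    · rintro _ ⟨⟨v, hv⟩, hv0, rfl⟩
      have key : ∀ v ∈ homSpan P, v - v.2 • hom x₀ ∈
          (vectorSpan ℝ P).map (LinearMap.inl ℝ E ℝ) := by
        intro v hv
        refine Submodule.span_induction ?_ ?_ ?_ ?_ hv
        · rintro _ ⟨x, hx, rfl⟩
          exact ⟨x - x₀, vsub_mem_vectorSpan ℝ hx hx₀, by simp [hom]⟩
        · simp
        · intro a b _ _ ha hb
          have := Submodule.add_mem _ ha hb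
          convert this using 1
          simp only [Prod.snd_add, add_smul]; abel
        · intro a b _ hb
          have := Submodule.smul_mem _ a hb
          convert this using 1
          simp only [Prod.smul_snd, smul_eq_mul, smul_sub, smul_smul]
      have h2 : v.2 = 0 := hv0
      simpa [h2] using key v hv
    · rw [Submodule.map_le_iff_le_comap, vectorSpan, Submodule.span_le]
      rintro _ ⟨x, hx, y, hy, rfl⟩
      refine ⟨⟨hom x, hom_mem_homSpan hx⟩ - ⟨hom y, hom_mem_homSpan hy⟩, ?_, ?_⟩
      · simp [hg]
      · simp [hom]
  have h2 := LinearEquiv.finrank_eq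
    (Submodule.equivMapOfInjective _ (homSpan P).injective_subtype (LinearMap.ker g))
  have h3 := LinearEquiv.finrank_eq
    (Submodule.equivMapOfInjective _ (LinearMap.inl_injective (R := ℝ) (M := E) (M₂ := ℝ))
      (vectorSpan ℝ P))
  rw [hr, finrank_top, Module.finrank_self] at h1
  rw [hk] at h2
  unfold dim
  omega

theorem mem_faces_iff [FiniteDimensional ℝ E] {P G : Set E} :
    G ∈ faces P ↔ ∃ f : E × ℝ →ₗ[ℝ] ℝ, NonnegOn f P ∧ G = {x ∈ P | f (hom x) = 0} := by
  constructor
  · intro h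
    rcases G.eq_empty_or_nonempty with rfl | hne
    -- The empty face is the zero set of the constant function 1.
    · refine ⟨LinearMap.snd ℝ E ℝ, fun x _ => by simp, ?_⟩
      ext x; simp
    · obtain ⟨l, hl⟩ := h hne
      obtain ⟨x₀, hx₀⟩ := hne
      have hx₀' := hx₀
      rw [hl] at hx₀'
      have hval : ∀ x, ((l x₀) • LinearMap.snd ℝ E ℝ - (l : E →ₗ[ℝ] ℝ).comp (LinearMap.fst ℝ E ℝ))
          (hom x) = l x₀ - l x := by intro x; simp
      refine ⟨(l x₀) • LinearMap.snd ℝ E ℝ - (l : E →ₗ[ℝ] ℝ).comp (LinearMap.fst ℝ E ℝ), ?_, ?_⟩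
      · intro x hx
        rw [hval]
        linarith [hx₀'.2 x hx]
      · ext x
        simp only [hval]
        constructor
        · intro hx
          rw [hl] at hx
          exact ⟨hx.1, by linarith [hx₀'.2 x hx.1, hx.2 x₀ hx₀'.1]⟩
        · rintro ⟨hx, h0⟩
          rw [hl]
          exact ⟨hx, fun y hy => by linarith [hx₀'.2 y hy]⟩
  · rintro ⟨f, hf, rfl⟩ ⟨x₀, hx₀, hx₀'⟩
    have hval : ∀ x, f (hom x) = f (x, 0) + f (0, 1) := by
      intro x; rw [← map_add]; simp [hom]
    refine ⟨-(LinearMap.toContinuousLinearMap (f.comp (LinearMap.inl ℝ E ℝ))), ?_⟩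
    ext x
    simp only [Set.mem_ofPred_eq, neg_apply,
      LinearMap.coe_toContinuousLinearMap', LinearMap.comp_apply, LinearMap.inl_apply]
    constructor
    · rintro ⟨hx, h0⟩
      refine ⟨hx, fun y hy => ?_⟩
      have := hf y hy
      rw [hval] at this h0
      linarith
    · rintro ⟨hx, h0⟩
      refine ⟨hx, ?_⟩
      have h1 := h0 x₀ hx₀
      have h2 := hf x hx
      rw [hval] at h2 hx₀' ⊢
      linarith

end Homogenization

/-! ### Facets as generators of the nonnegative affine functions -/

section Facets

variable {E F : Type*} [NormedAddCommGroup E] [NormedSpace ℝ E] [FiniteDimensional ℝ E]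
  [NormedAddCommGroup F] [NormedSpace ℝ F] [FiniteDimensional ℝ F]

/-- The maximal proper faces. -/
def maxFaces (P : Set E) : Set (Set E) :=
  {G | G ∈ faces P ∧ G ≠ P ∧ ∀ G' ∈ faces P, G ⊆ G' → G' ≠ P → G' = G}

theorem faces_subset {P G : Set E} (h : G ∈ faces P) : G ⊆ P := by
  obtain ⟨f, -, rfl⟩ := mem_faces_iff.1 h
  exact Set.sep_subset _ _

/-- A facet spans a hyperplane of `homSpan P`, so a larger proper face has the same span, and a face
is cut out of P by its span. Maximality is a purely order-theoretic notion, so it can be transported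
along isomorphisms of face lattices. -/
theorem facets_subset_maxFaces (P : Set E) : facets P ⊆ maxFaces P := by
  rintro G ⟨hG, hne, hdim⟩
  have hPne : P.Nonempty := hne.mono (faces_subset hG)
  have hr := finrank_homSpan hne
  have hrP := finrank_homSpan hPne
  refine ⟨hG, ?_, ?_⟩
  · rintro rfl
    omega
  · intro G' hG' hsub hne'
    have hG'P := faces_subset hG'
    obtain ⟨g, -, rfl⟩ := mem_faces_iff.1 hG'
    obtain ⟨f, -, hGf⟩ := mem_faces_iff.1 hG
    have hlt : homSpan {x ∈ P | g (hom x) = 0} < homSpan P := by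
      refine lt_of_le_of_ne (homSpan_mono hG'P) ?_
      intro heq
      apply hne'
      refine Set.Subset.antisymm hG'P fun x hx => ⟨hx, ?_⟩
      exact eq_on_homSpan (g := 0) (fun y hy => by simpa using hy.2) (heq ▸ hom_mem_homSpan hx)
    have h1 := Submodule.finrank_lt_finrank_of_lt hlt
    have h2 : homSpan G = homSpan {x ∈ P | g (hom x) = 0} :=
      Submodule.eq_of_le_of_finrank_le (homSpan_mono hsub) (by omega)
    refine Set.Subset.antisymm (fun x hx => ?_) hsub
    have h3 : hom x ∈ homSpan G := h2 ▸ hom_mem_homSpan hx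
    have h4 : f (hom x) = (0 : E × ℝ →ₗ[ℝ] ℝ) (hom x) := by
      refine eq_on_homSpan (fun y hy => ?_) h3
      rw [hGf] at hy
      simpa using hy.2
    rw [hGf]
    exact ⟨hx.1, by simpa using h4⟩

/-- Where a nonnegative combination of the generators vanishes, every generator with nonzero
coefficient vanishes. So a maximal face lies in the zero set of a single generator that is not
identically zero, and equals it. -/
theorem Generated.maxFaces_le {P : Set E} {ι : Type*} [Fintype ι] (h : Generated P ι) :
    (maxFaces P).Finite ∧ (maxFaces P).ncard ≤ Fintype.card ι := by
  obtain ⟨l, hl, hgen⟩ := h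
  have hsub : maxFaces P ⊆ Set.range fun i => {x ∈ P | l i (hom x) = 0} := by
    rintro G ⟨hG, hne, hmax⟩
    obtain ⟨f, hf, rfl⟩ := mem_faces_iff.1 hG
    obtain ⟨c, hc, hfc⟩ := hgen f hf
    have hzero : ∀ x ∈ P, f (hom x) = 0 → ∀ i, c i ≠ 0 → l i (hom x) = 0 := by
      intro x hx h0 i hi
      rw [hfc x hx, Finset.sum_eq_zero_iff_of_nonneg
        (fun j _ => mul_nonneg (hc j) (hl j x hx))] at h0
      exact (mul_eq_zero.1 (h0 i (Finset.mem_univ i))).resolve_left hi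
    have : ∃ i, c i ≠ 0 ∧ ∃ x ∈ P, l i (hom x) ≠ 0 := by
      by_contra! hcon
      apply hne
      refine Set.Subset.antisymm (Set.sep_subset _ _) fun x hx => ⟨hx, ?_⟩
      rw [hfc x hx]
      refine Finset.sum_eq_zero fun i _ => ?_
      by_cases hi : c i = 0
      · simp [hi]
      · simp [hcon i hi x hx]
    obtain ⟨i, hi, x, hx, hxi⟩ := this
    refine ⟨i, hmax _ (mem_faces_iff.2 ⟨l i, hl i, rfl⟩) ?_ ?_⟩
    · rintro y ⟨hy, hy0⟩
      exact ⟨hy, hzero y hy hy0 i hi⟩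
    · intro heq
      rw [← heq] at hx
      exact hxi hx.2
  have hfin : (Set.range fun i => {x ∈ P | l i (hom x) = 0}).Finite := Set.finite_range _
  refine ⟨hfin.subset hsub, (Set.ncard_le_ncard hsub hfin).trans ?_⟩
  rw [← Set.image_univ]
  refine (Set.ncard_image_le Set.finite_univ).trans ?_
  rw [Set.ncard_univ, Nat.card_eq_fintype_card]

theorem Generated.facets_le {P : Set E} {ι : Type*} [Fintype ι] (h : Generated P ι) :
    (facets P).ncard ≤ Fintype.card ι :=
  (Set.ncard_le_ncard (facets_subset_maxFaces P) h.maxFaces_le.1).trans h.maxFaces_le.2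

theorem Generated.reindex {P : Set E} {ι κ : Type*} [Fintype ι] [Fintype κ] (h : Generated P ι)
    (e : ι ≃ κ) : Generated P κ := by
  obtain ⟨l, hl, hgen⟩ := h
  refine ⟨l ∘ e.symm, fun i => hl _, fun f hf => ?_⟩
  obtain ⟨c, hc, hfc⟩ := hgen f hf
  refine ⟨c ∘ e.symm, fun i => hc _, fun x hx => ?_⟩
  rw [hfc x hx, ← e.symm.sum_comp]
  rfl

theorem finite_faces_convexHull {S : Set E} (hS : S.Finite) : (faces (convexHull ℝ S)).Finite := by
  refine (hS.finite_subsets.image (convexHull ℝ)).subset fun G hG => ?_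
  obtain ⟨f, hf, rfl⟩ := mem_faces_iff.1 hG
  refine ⟨{x ∈ S | f (hom x) = 0}, Set.sep_subset _ _, ?_⟩
  exact (zeros_convexHull fun x hx => hf x (subset_convexHull _ _ hx)).symm

theorem finrank_inf_ker {V : Type*} [AddCommGroup V] [Module ℝ V] [FiniteDimensional ℝ V]
    {W : Submodule ℝ V} {f : V →ₗ[ℝ] ℝ} {v : V} (hv : v ∈ W) (hf : f v ≠ 0) :
    Module.finrank ℝ (W ⊓ LinearMap.ker f : Submodule ℝ V) + 1 = Module.finrank ℝ W := by
  have h1 := LinearMap.finrank_range_add_finrank_ker (f.domRestrict W)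
  have hr : LinearMap.range (f.domRestrict W) = ⊤ := by
    rw [LinearMap.range_eq_top]
    intro t
    exact ⟨(t / f v) • ⟨v, hv⟩, by simp [hf]⟩
  rw [hr, finrank_top, Module.finrank_self] at h1
  have hk : (LinearMap.ker (f.domRestrict W)).map W.subtype = W ⊓ LinearMap.ker f := by
    ext x
    simp only [Submodule.mem_map, LinearMap.mem_ker, Submodule.mem_inf]
    constructor
    · rintro ⟨y, hy, rfl⟩
      exact ⟨y.2, hy⟩
    · rintro ⟨h1, h2⟩
      exact ⟨⟨x, h1⟩, h2, rfl⟩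
  have h2 := LinearEquiv.finrank_eq
    (Submodule.equivMapOfInjective _ W.injective_subtype (LinearMap.ker (f.domRestrict W)))
  rw [hk] at h2
  omega

theorem dim_pos {P : Set E} (h : P.Nontrivial) : 0 < dim P := by
  obtain ⟨x, hx, y, hy, hxy⟩ := h
  refine Module.finrank_pos_iff_exists_ne_zero.2 ⟨⟨x -ᵥ y, vsub_mem_vectorSpan ℝ hx hy⟩, ?_⟩
  simpa [Subtype.ext_iff, sub_eq_zero] using hxy

/-- A nonnegative affine function that does not vanish identically either defines a facet or is
a combination of two nonnegative functions that vanish on more points. -/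
theorem facet_or_split {S : Set E} (hS : S.Finite) (hnt : (convexHull ℝ S).Nontrivial)
    {f : E × ℝ →ₗ[ℝ] ℝ} (hf : NonnegOn f S) {s₀ : E} (hs₀ : s₀ ∈ S) (hfs₀ : f (hom s₀) ≠ 0) :
    ({x ∈ convexHull ℝ S | f (hom x) = 0} ∈ facets (convexHull ℝ S) ∧
      homSpan {x ∈ S | f (hom x) = 0} = homSpan S ⊓ LinearMap.ker f) ∨
    ∃ f₁ f₂ : E × ℝ →ₗ[ℝ] ℝ, NonnegOn f₁ S ∧ NonnegOn f₂ S ∧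
      {x ∈ S | f₁ (hom x) ≠ 0} ⊂ {x ∈ S | f (hom x) ≠ 0} ∧
      {x ∈ S | f₂ (hom x) ≠ 0} ⊂ {x ∈ S | f (hom x) ≠ 0} ∧
      ∃ t : ℝ, 0 ≤ t ∧ f = t • (f₁ + f₂) := by
  have hle : homSpan {x ∈ S | f (hom x) = 0} ≤ homSpan S ⊓ LinearMap.ker f := by
    refine le_inf (homSpan_mono (Set.sep_subset _ _)) (Submodule.span_le.2 ?_)
    rintro _ ⟨x, hx, rfl⟩
    exact hx.2
  have hnt' : 0 < dim (convexHull ℝ S) := dim_pos hnt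
  have hrP := finrank_homSpan hnt.nonempty
  rw [homSpan_convexHull] at hrP
  rcases hle.eq_or_lt with heq | hlt
  · left
    refine ⟨?_, heq⟩
    have hr := finrank_inf_ker (hom_mem_homSpan hs₀) hfs₀
    rw [← heq] at hr
    have hZ : {x ∈ S | f (hom x) = 0}.Nonempty := by
      by_contra hcon
      rw [Set.not_nonempty_iff_eq_empty] at hcon
      rw [hcon] at hr
      have h0 : homSpan (∅ : Set E) = ⊥ := by simp [homSpan]
      rw [h0, finrank_bot] at hr
      omega
    refine ⟨mem_faces_iff.2 ⟨f, hf.convexHull, rfl⟩, ?_, ?_⟩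
    · rw [zeros_convexHull hf]
      exact hZ.convexHull
    · have h2 := finrank_homSpan (hZ.convexHull (𝕜 := ℝ))
      rw [homSpan_convexHull] at h2
      rw [zeros_convexHull hf]
      omega
  · right
    obtain ⟨h, hh, hhn⟩ := Set.exists_of_ssubset hlt
    obtain ⟨m, hm, hmk⟩ := Submodule.exists_le_ker_of_notMem hhn
    have hmZ : ∀ x ∈ S, f (hom x) = 0 → m (hom x) = 0 := fun x hx h0 =>
      hmk (hom_mem_homSpan ⟨hx, h0⟩)
    have hpos : ∀ x ∈ S, f (hom x) ≠ 0 → 0 < f (hom x) := fun x hx h0 =>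
      lt_of_le_of_ne (hf x hx) (Ne.symm h0)
    have hTfin : {x ∈ S | f (hom x) ≠ 0}.Finite := hS.subset (Set.sep_subset _ _)
    -- If the zeros of f span too little, some m vanishes on them without being proportional to f.
    -- With M and μ the extreme values of m / f, both M f − m and m − μ f are nonnegative, each has
    -- a new zero where the extreme is attained, and they add up to (M − μ) f.
    obtain ⟨a, ha, hamax⟩ := Set.exists_max_image _ (fun x => m (hom x) / f (hom x)) hTfin
      ⟨s₀, hs₀, hfs₀⟩
    obtain ⟨b, hb, hbmin⟩ := Set.exists_min_image _ (fun x => m (hom x) / f (hom x)) hTfin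
      ⟨s₀, hs₀, hfs₀⟩
    set M := m (hom a) / f (hom a) with hM
    set μ := m (hom b) / f (hom b) with hμ
    have hlt : μ < M := by
      by_contra! hcon
      apply hm
      have : m h = (M • f) h := by
        refine eq_on_homSpan (P := S) (fun x hx => ?_) hh.1
        by_cases h0 : f (hom x) = 0
        · simp [h0, hmZ x hx h0]
        · have h1 := hamax x ⟨hx, h0⟩
          have h2 := hbmin x ⟨hx, h0⟩
          have h3 : m (hom x) / f (hom x) = M := le_antisymm h1 (hcon.trans h2)
          rw [LinearMap.smul_apply, smul_eq_mul, ← h3, div_mul_cancel₀ _ h0]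
      rw [this, LinearMap.smul_apply, show f h = 0 from hh.2, smul_zero]
    refine ⟨M • f - m, m - μ • f, ?_, ?_, ?_, ?_, (M - μ)⁻¹, by
      rw [inv_nonneg]; linarith, ?_⟩
    · intro x hx
      by_cases h0 : f (hom x) = 0
      · simp [h0, hmZ x hx h0]
      · have := (div_le_iff₀ (hpos x hx h0)).1 (hamax x ⟨hx, h0⟩)
        simpa using this
    · intro x hx
      by_cases h0 : f (hom x) = 0
      · simp [h0, hmZ x hx h0]
      · have := (le_div_iff₀ (hpos x hx h0)).1 (hbmin x ⟨hx, h0⟩)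
        simpa using this
    · refine (Set.ssubset_iff_of_subset ?_).2 ⟨a, ha, ?_⟩
      · rintro x ⟨hx, h0⟩
        refine ⟨hx, fun h1 => h0 ?_⟩
        simp [h1, hmZ x hx h1]
      · rintro ⟨-, h0⟩
        apply h0
        simp [hM, div_mul_cancel₀ _ ha.2]
    · refine (Set.ssubset_iff_of_subset ?_).2 ⟨b, hb, ?_⟩
      · rintro x ⟨hx, h0⟩
        refine ⟨hx, fun h1 => h0 ?_⟩
        simp [h1, hmZ x hx h1]
      · rintro ⟨-, h0⟩
        apply h0
        simp [hμ, div_mul_cancel₀ _ hb.2]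
    · rw [show M • f - m + (m - μ • f) = (M - μ) • f by module, smul_smul,
        inv_mul_cancel₀ (by linarith), one_smul]

/-- Splitting a nonnegative function repeatedly strictly increases its zero set, so the process ends
with functions that define facets. A single point must be excluded: it has no facets, but the
constant 1 still needs a generator. -/
theorem generated_facets {S : Set E} (hS : S.Finite) (hnt : (convexHull ℝ S).Nontrivial) :
    (facets (convexHull ℝ S)).Finite ∧
      Generated (convexHull ℝ S) (Fin (facets (convexHull ℝ S)).ncard) := by
  set P := convexHull ℝ S with hP
  have hfin : (facets P).Finite := (finite_faces_convexHull hS).subset fun G hG => hG.1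
  refine ⟨hfin, ?_⟩
  let _ := hfin.fintype
  have hcard : Fintype.card (facets P) = (facets P).ncard := by
    rw [← Nat.card_eq_fintype_card]; rfl
  suffices h : Generated P (facets P) from h.reindex (Fintype.equivFinOfCardEq hcard)
  have hex : ∀ G : facets P, ∃ f : E × ℝ →ₗ[ℝ] ℝ, NonnegOn f P ∧
      (G : Set E) = {x ∈ P | f (hom x) = 0} := fun G => mem_faces_iff.1 G.2.1
  choose l hl hlG using hex
  refine ⟨l, hl, ?_⟩
  have key : ∀ (n : ℕ) (f : E × ℝ →ₗ[ℝ] ℝ), NonnegOn f S →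
      {x ∈ S | f (hom x) ≠ 0}.ncard ≤ n → ∃ c : facets P → ℝ, (∀ i, 0 ≤ c i) ∧
        ∀ x ∈ S, f (hom x) = ∑ i, c i * l i (hom x) := by
    intro n
    induction n with
    | zero =>
      intro f hf hn
      have h0 : {x ∈ S | f (hom x) ≠ 0} = ∅ := by
        rwa [Nat.le_zero, Set.ncard_eq_zero (hS.subset (Set.sep_subset _ _))] at hn
      refine ⟨0, fun _ => le_rfl, fun x hx => ?_⟩
      by_contra hne
      have : x ∈ {x ∈ S | f (hom x) ≠ 0} := ⟨hx, by simpa using hne⟩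
      rw [h0] at this
      exact this
    | succ n ih =>
      intro f hf hn
      by_cases hall : ∀ s ∈ S, f (hom s) = 0
      · exact ⟨0, fun _ => le_rfl, fun x hx => by simpa using hall x hx⟩
      push Not at hall
      obtain ⟨s₀, hs₀, hfs₀⟩ := hall
      rcases facet_or_split hS hnt hf hs₀ hfs₀ with ⟨hfac, hspan⟩ |
        ⟨f₁, f₂, h1, h2, hs1, hs2, t, ht, hft⟩
      · set G : facets P := ⟨_, hfac⟩ with hG
        have hls : l G (hom s₀) ≠ 0 := by
          intro h0
          have : s₀ ∈ (G : Set E) := by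
            rw [hlG]; exact ⟨subset_convexHull _ _ hs₀, h0⟩
          exact hfs₀ this.2
        have hls' : 0 < l G (hom s₀) :=
          lt_of_le_of_ne (hl G _ (subset_convexHull _ _ hs₀)) (Ne.symm hls)
        have hfs' : 0 < f (hom s₀) := lt_of_le_of_ne (hf _ hs₀) (Ne.symm hfs₀)
        -- The chosen functional of the facet and f have the same kernel on the span, so f is a
        -- multiple of it there; `s₀` fixes the factor.
        have hker : ∀ v ∈ homSpan S ⊓ LinearMap.ker f, l G v = 0 := by
          intro v hv
          rw [← hspan] at hv
          refine eq_on_homSpan (g := 0) (fun x hx => ?_) hv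
          have : x ∈ (G : Set E) := ⟨subset_convexHull _ _ hx.1, hx.2⟩
          rw [hlG] at this
          simpa using this.2
        classical
        refine ⟨Pi.single G (f (hom s₀) / l G (hom s₀)), ?_, ?_⟩
        · intro i
          by_cases hi : i = G
          · subst hi; simp only [Pi.single_eq_same]; positivity
          · simp [Pi.single_eq_of_ne hi]
        · intro x hx
          rw [Finset.sum_eq_single G (fun i _ hi => by simp [Pi.single_eq_of_ne hi]) (by simp),
            Pi.single_eq_same]
          have h3 := hker (hom x - (f (hom x) / f (hom s₀)) • hom s₀)
            ⟨Submodule.sub_mem _ (hom_mem_homSpan hx)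
              (Submodule.smul_mem _ _ (hom_mem_homSpan hs₀)), by
              simp [div_mul_cancel₀ _ hfs₀]⟩
          rw [map_sub, map_smul, smul_eq_mul, sub_eq_zero] at h3
          rw [h3]
          field_simp
      · have hTfin : {x ∈ S | f (hom x) ≠ 0}.Finite := hS.subset (Set.sep_subset _ _)
        obtain ⟨c₁, hc₁, hfc₁⟩ := ih f₁ h1 (by have := Set.ncard_lt_ncard hs1 hTfin; omega)
        obtain ⟨c₂, hc₂, hfc₂⟩ := ih f₂ h2 (by have := Set.ncard_lt_ncard hs2 hTfin; omega)
        refine ⟨t • (c₁ + c₂), fun i => mul_nonneg ht (add_nonneg (hc₁ i) (hc₂ i)),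
          fun x hx => ?_⟩
        rw [hft, LinearMap.smul_apply, LinearMap.add_apply, hfc₁ x hx, hfc₂ x hx,
          ← Finset.sum_add_distrib, Finset.smul_sum]
        refine Finset.sum_congr rfl fun i _ => ?_
        simp only [Pi.smul_apply, Pi.add_apply, smul_eq_mul]
        ring
  intro f hf
  obtain ⟨c, hc, hfc⟩ := key _ f (fun x hx => hf x (subset_convexHull _ _ hx)) le_rfl
  refine ⟨c, hc, fun x hx => ?_⟩
  have := eq_on_convexHull (f := f) (g := ∑ i, c i • l i)
    (fun y hy => by rw [hfc y hy]; simp) hx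
  simpa using this

end Facets

/-! ### Extensions and the cost of adding a point -/

section ExtensionComplexity

variable {E F : Type*} [NormedAddCommGroup E] [NormedSpace ℝ E] [FiniteDimensional ℝ E]
  [NormedAddCommGroup F] [NormedSpace ℝ F] [FiniteDimensional ℝ F]

theorem Generated.image {P : Set E} {ι : Type*} [Fintype ι] (h : Generated P ι) (π : E →ᵃ[ℝ] F)
    (σ : F × ℝ →ₗ[ℝ] E × ℝ) (hσ : ∀ x ∈ P, σ (hom (π x)) = hom x) : Generated (π '' P) ι := by
  obtain ⟨l, hl, hgen⟩ := h
  refine ⟨fun i => (l i).comp σ, ?_, ?_⟩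
  · rintro i _ ⟨x, hx, rfl⟩
    simpa [hσ x hx] using hl i x hx
  · intro f hf
    obtain ⟨c, hc, hfc⟩ := hgen (f.comp (homMap π)) fun x hx => by
      simpa using hf _ ⟨x, hx, rfl⟩
    refine ⟨c, hc, ?_⟩
    rintro _ ⟨x, hx, rfl⟩
    simpa [hσ x hx] using hfc x hx

/-- Bounds xc by counting generating functions instead of facets, and allows the extension to live
in any finite-dimensional space. -/
theorem xc_le {S : Set F} (hS : S.Finite) {ι : Type*} [Fintype ι]
    (h : Generated (convexHull ℝ S) ι) (π : F →ᵃ[ℝ] E) :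
    xc (π '' convexHull ℝ S) ≤ Fintype.card ι := by
  let e : F ≃ₗ[ℝ] EuclideanSpace ℝ (Fin (Module.finrank ℝ F)) := toEuclidean.toLinearEquiv
  have h1 := h.image e.toLinearMap.toAffineMap (homMap e.symm.toLinearMap.toAffineMap)
    (fun x _ => by simp)
  refine le_trans (Nat.sInf_le ⟨_, e.toLinearMap.toAffineMap '' convexHull ℝ S,
    π.comp e.symm.toLinearMap.toAffineMap, ⟨e.toLinearMap.toAffineMap '' S, hS.image _, ?_⟩, ?_,
    rfl⟩) h1.facets_le
  · rw [AffineMap.image_convexHull]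
  · rw [← Set.image_comp]
    congr 1
    ext x
    simp

theorem exists_extension {P : Set E} (hP : IsPolytope P) :
    ∃ (m : ℕ) (Q : Set (EuclideanSpace ℝ (Fin m))) (π : EuclideanSpace ℝ (Fin m) →ᵃ[ℝ] E),
      IsPolytope Q ∧ π '' Q = P ∧ (facets Q).ncard = xc P := by
  obtain ⟨S, hS, rfl⟩ := hP
  let e : E ≃ₗ[ℝ] EuclideanSpace ℝ (Fin (Module.finrank ℝ E)) := toEuclidean.toLinearEquiv
  refine Nat.sInf_mem (s := {k : ℕ | ∃ (m : ℕ) (Q : Set (EuclideanSpace ℝ (Fin m)))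
    (π : EuclideanSpace ℝ (Fin m) →ᵃ[ℝ] E),
    IsPolytope Q ∧ π '' Q = convexHull ℝ S ∧ (facets Q).ncard = k}) ⟨_, _,
    e.toLinearMap.toAffineMap '' convexHull ℝ S, e.symm.toLinearMap.toAffineMap,
    ⟨e.toLinearMap.toAffineMap '' S, hS.image _, ?_⟩, ?_, rfl⟩
  · rw [AffineMap.image_convexHull]
  · rw [← Set.image_comp]
    simp [Function.comp_def]

/-- An extension of a nondegenerate polytope, with the facet functionals of the extension. -/
theorem exists_generated_extension {P : Set E} (hP : IsPolytope P) (hnt : P.Nontrivial) :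
    ∃ (m : ℕ) (S : Set (EuclideanSpace ℝ (Fin m))) (π : EuclideanSpace ℝ (Fin m) →ᵃ[ℝ] E),
      S.Finite ∧ π '' convexHull ℝ S = P ∧ Generated (convexHull ℝ S) (Fin (xc P)) := by
  obtain ⟨m, _, π, ⟨S, hS, rfl⟩, hπ, hk⟩ := exists_extension hP
  refine ⟨m, S, π, hS, hπ, ?_⟩
  rw [← hk]
  refine (generated_facets hS ?_).2
  rw [← hπ] at hnt
  obtain ⟨_, ⟨x, hx, rfl⟩, _, ⟨y, hy, rfl⟩, hxy⟩ := hnt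
  exact ⟨x, hx, y, hy, fun h => hxy (h ▸ rfl)⟩

theorem Generated.pyramid {S : Set F} {ι : Type*} [Fintype ι]
    (h : Generated (convexHull ℝ S) ι) :
    Generated (convexHull ℝ (insert ((0 : F), (1 : ℝ)) ((fun s => (s, (0 : ℝ))) '' S)))
      (Option ι) := by
  obtain ⟨l, hl, hgen⟩ := h
  -- `A` kills the apex and is the identity on the base, so functions on the base extend to the
  -- pyramid with value 0 at the apex. The remaining generator is the new coordinate, which is 0 on
  -- the base and 1 at the apex.
  let A : (F × ℝ) × ℝ →ₗ[ℝ] F × ℝ :=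
    ((LinearMap.fst ℝ F ℝ).comp (LinearMap.fst ℝ (F × ℝ) ℝ)).prod
      (LinearMap.snd ℝ (F × ℝ) ℝ - (LinearMap.snd ℝ F ℝ).comp (LinearMap.fst ℝ (F × ℝ) ℝ))
  have hA : ∀ s : F, A (hom (s, 0)) = hom s := fun s => by simp [A, hom]
  have hA' : A (hom (0, 1)) = 0 := by simp [A, hom]
  refine ⟨fun i => i.elim ((LinearMap.snd ℝ F ℝ).comp (LinearMap.fst ℝ (F × ℝ) ℝ))
    fun i => (l i).comp A, ?_, ?_⟩
  · intro i
    refine NonnegOn.convexHull ?_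
    rintro x (rfl | ⟨s, hs, rfl⟩)
    · cases i with
      | none => simp
      | some i => simp [hA']
    · cases i with
      | none => simp
      | some i => simpa [hA] using hl i s (subset_convexHull _ _ hs)
  · intro f hf
    let B : F × ℝ →ₗ[ℝ] (F × ℝ) × ℝ :=
      ((LinearMap.inl ℝ F ℝ).comp (LinearMap.fst ℝ F ℝ)).prod (LinearMap.snd ℝ F ℝ)
    have hB : ∀ s : F, B (hom s) = hom (s, 0) := fun s => by simp [B, hom]
    obtain ⟨c, hc, hfc⟩ := hgen (f.comp B) <| NonnegOn.convexHull fun s hs => by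
      simpa [hB] using hf _ (subset_convexHull _ _ (Or.inr ⟨s, hs, rfl⟩))
    refine ⟨fun i => i.elim (f (hom (0, 1))) c, ?_, ?_⟩
    · intro i
      cases i with
      | none => exact hf _ (subset_convexHull _ _ (Or.inl rfl))
      | some i => exact hc i
    · intro x hx
      have := eq_on_convexHull (f := f) (g := f (hom (0, 1)) •
        ((LinearMap.snd ℝ F ℝ).comp (LinearMap.fst ℝ (F × ℝ) ℝ)) + ∑ i, c i • (l i).comp A)
        ?_ hx
      · rw [this]
        simp [Fintype.sum_option]
      · rintro x (rfl | ⟨s, hs, rfl⟩)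
        · simp [hA']
        · simpa [hA, hB] using hfc s (subset_convexHull _ _ hs)

/-- The pyramid over an extension of T projects onto the new hull, with its apex sent to `a`. The
point `a` may lie anywhere; only the extension has to be a genuine pyramid. -/
theorem xc_insert_le {T : Set E} (hT : IsPolytope T) (hnt : T.Nontrivial) (a : E) :
    xc (convexHull ℝ (insert a T)) ≤ xc T + 1 := by
  obtain ⟨m, S, π, hS, hπ, hgen⟩ := exists_generated_extension hT hnt
  let ρ : EuclideanSpace ℝ (Fin m) × ℝ →ᵃ[ℝ] E :=
    π.comp (LinearMap.fst ℝ _ ℝ).toAffineMap +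
      ((LinearMap.toSpanSingleton ℝ E (a - π 0)).comp (LinearMap.snd ℝ _ ℝ)).toAffineMap
  have h := xc_le ((hS.image fun s => (s, (0 : ℝ))).insert ((0 : EuclideanSpace ℝ (Fin m)), 1))
    hgen.pyramid ρ
  rw [Fintype.card_option, Fintype.card_fin] at h
  have him : ρ '' convexHull ℝ (insert ((0 : EuclideanSpace ℝ (Fin m)), (1 : ℝ))
      ((fun s => (s, (0 : ℝ))) '' S)) = convexHull ℝ (insert a T) := by
    rw [AffineMap.image_convexHull, Set.image_insert_eq, ← Set.image_comp]
    have h1 : ρ (0, 1) = a := by simp [ρ]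
    have h2 : ρ ∘ (fun s => (s, (0 : ℝ))) = π := by ext s; simp [ρ]
    rw [h1, h2, ← hπ, AffineMap.image_convexHull, Set.insert_eq, Set.insert_eq,
      convexHull_convexHull_union_right]
  rwa [him] at h

theorem xc_union_le {T A : Set E} (hT : IsPolytope T) (hnt : T.Nontrivial) (hA : A.Finite) :
    xc (convexHull ℝ (T ∪ A)) ≤ xc T + A.ncard := by
  induction A, hA using Set.Finite.induction_on with
  | empty =>
    obtain ⟨S, -, rfl⟩ := hT
    simp [(convex_convexHull ℝ S).convexHull_eq]
  | @insert a A ha hA ih =>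
    rw [Set.ncard_insert_of_notMem ha hA, Set.union_insert, Set.insert_eq,
      ← convexHull_convexHull_union_right, ← Set.insert_eq]
    have hP : IsPolytope (convexHull ℝ (T ∪ A)) := by
      obtain ⟨S, hS, rfl⟩ := hT
      exact ⟨S ∪ A, hS.union hA, by rw [convexHull_convexHull_union_left]⟩
    have := xc_insert_le hP (hnt.mono (Set.subset_union_left.trans (subset_convexHull _ _))) a
    omega

theorem IsPyramid.xc_le {H : Set E} (hH : IsPolytope H) (hnt : H.Nontrivial) :
    ∀ {k : ℕ} {P : Set E}, IsPyramid k H P →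
      IsPolytope P ∧ P.Nontrivial ∧ xc P ≤ xc H + k
  | 0, P, h => by
    obtain rfl : P = H := h
    exact ⟨hH, hnt, le_rfl⟩
  | k + 1, P, ⟨R, a, hR, _, hP⟩ => by
    obtain ⟨h1, h2, h3⟩ := IsPyramid.xc_le hH hnt hR
    subst hP
    refine ⟨?_, h2.mono ((Set.subset_insert _ _).trans (subset_convexHull _ _)), ?_⟩
    · obtain ⟨S, hS, rfl⟩ := h1
      exact ⟨insert a S, hS.insert a, by
        rw [Set.insert_eq, Set.insert_eq, convexHull_convexHull_union_right]⟩
    · have := xc_insert_le h1 h2 a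
      omega

end ExtensionComplexity

/-! ### Prisms and Desarguian hexagons have extension complexity at most five -/

section UpperBounds

variable {E F : Type*} [NormedAddCommGroup E] [NormedSpace ℝ E] [FiniteDimensional ℝ E]
  [NormedAddCommGroup F] [NormedSpace ℝ F] [FiniteDimensional ℝ F]

section JoinedSimplices

variable {ι κ : Type*} [Fintype ι] [Fintype κ] [DecidableEq ι] [DecidableEq κ]

/-- The vertices `(e_i, e_j)` of a product of two simplices. -/
def prodVertex (ij : ι × κ) : (ι → ℝ) × (κ → ℝ) := (Pi.single ij.1 1, Pi.single ij.2 1)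

/-- The product of simplices with its vertices moved along their rays. -/
def scaledProd (h : (ι → ℝ) × (κ → ℝ) →ₗ[ℝ] ℝ) : Set ((ι → ℝ) × (κ → ℝ)) :=
  Set.range fun ij : ι × κ => (h (prodVertex ij))⁻¹ • prodVertex ij

/-- The cone over the scaled product is a linear image of the cone over the product, so the
coordinate functions still generate. A functional takes the form a i + b j on the unscaled vertices.
-/
theorem generated_scaledProd [Nonempty ι] (h : (ι → ℝ) × (κ → ℝ) →ₗ[ℝ] ℝ)
    (hpos : ∀ ij : ι × κ, 0 < h (prodVertex ij)) :
    Generated (convexHull ℝ (scaledProd h)) (ι ⊕ κ) := by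
  have hhom : ∀ ij : ι × κ, hom ((h (prodVertex ij))⁻¹ • prodVertex ij) =
      (h (prodVertex ij))⁻¹ • (prodVertex ij, h (prodVertex ij)) := by
    intro ij
    ext1
    · simp [hom]
    · simp [hom, (hpos ij).ne']
  let l : ι ⊕ κ → (((ι → ℝ) × (κ → ℝ)) × ℝ →ₗ[ℝ] ℝ) := Sum.elim
    (fun i => (LinearMap.proj i).comp ((LinearMap.fst ℝ _ _).comp (LinearMap.fst ℝ _ _)))
    (fun j => (LinearMap.proj j).comp ((LinearMap.snd ℝ _ _).comp (LinearMap.fst ℝ _ _)))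
  refine ⟨l, ?_, ?_⟩
  · intro i
    refine NonnegOn.convexHull ?_
    rintro _ ⟨ij, rfl⟩
    rw [hhom, map_smul, smul_eq_mul]
    refine mul_nonneg (inv_nonneg.2 (hpos ij).le) ?_
    cases i with
    | inl i => simp only [l, prodVertex]; simp [Pi.single_apply]; split_ifs <;> norm_num
    | inr i => simp only [l, prodVertex]; simp [Pi.single_apply]; split_ifs <;> norm_num
  · intro f hf
    let φ : (ι → ℝ) × (κ → ℝ) →ₗ[ℝ] ℝ := f.comp (LinearMap.id.prod h)
    set a : ι → ℝ := fun i => φ (Pi.single i 1, 0) with ha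
    set b : κ → ℝ := fun j => φ (0, Pi.single j 1) with hb
    have hφ : ∀ ij : ι × κ, φ (prodVertex ij) = a ij.1 + b ij.2 := by
      intro ij
      simp only [ha, hb]
      rw [← map_add]
      simp [prodVertex]
    have hfφ : ∀ ij : ι × κ, f (prodVertex ij, h (prodVertex ij)) = a ij.1 + b ij.2 := by
      intro ij
      rw [← hφ]
      rfl
    have hnn : ∀ ij : ι × κ, 0 ≤ a ij.1 + b ij.2 := by
      intro ij
      have h1 := hf _ (subset_convexHull _ _ ⟨ij, rfl⟩)
      rw [hhom, map_smul, hfφ, smul_eq_mul] at h1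
      exact nonneg_of_mul_nonneg_right h1 (inv_pos.2 (hpos ij))
    obtain ⟨i₀, hi₀⟩ := Finite.exists_min a
    -- Shifting by the least a i makes both families nonnegative without changing the sums a i + b
    -- j.
    refine ⟨Sum.elim (fun i => a i - a i₀) (fun j => b j + a i₀), ?_, ?_⟩
    · rintro (i | j)
      · simpa using hi₀ i
      · simpa [add_comm] using hnn (i₀, j)
    · intro x hx
      have := eq_on_convexHull (f := f) (g := ∑ s, (Sum.elim (fun i => a i - a i₀)
        (fun j => b j + a i₀) s : ℝ) • l s) ?_ hx
      · rw [this]; simp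
      · rintro _ ⟨ij, rfl⟩
        rw [hhom, map_smul, map_smul, hfφ]
        congr 1
        simp [l, prodVertex, Fintype.sum_sum_type, Pi.single_apply]

end JoinedSimplices

theorem maxFaces_ncard_le_of_combEquiv {P : Set E} {Q : Set F} (h : CombEquiv P Q)
    (hfin : (maxFaces Q).Finite) : (maxFaces P).ncard ≤ (maxFaces Q).ncard := by
  obtain ⟨φ⟩ := h
  have htopP : P ∈ faces P := mem_faces_iff.2 ⟨0, fun _ _ => le_rfl, by simp⟩
  have htopQ : Q ∈ faces Q := mem_faces_iff.2 ⟨0, fun _ _ => le_rfl, by simp⟩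
  have hφP : φ ⟨P, htopP⟩ = ⟨Q, htopQ⟩ := by
    apply le_antisymm
    · exact faces_subset (φ ⟨P, htopP⟩).2
    · rw [← φ.apply_symm_apply ⟨Q, htopQ⟩]
      exact φ.monotone (faces_subset (φ.symm ⟨Q, htopQ⟩).2)
  classical
  let g : Set E → Set F := fun G => if h : G ∈ faces P then (φ ⟨G, h⟩ : Set F) else ∅
  have hg : ∀ G (h : G ∈ faces P), g G = φ ⟨G, h⟩ := fun G h => dif_pos h
  refine Set.ncard_le_ncard_of_injOn g ?_ ?_ hfin
  · rintro G ⟨hG, hne, hmax⟩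
    rw [hg G hG]
    refine ⟨(φ ⟨G, hG⟩).2, ?_, ?_⟩
    · intro heq
      have : φ ⟨G, hG⟩ = φ ⟨P, htopP⟩ := by rw [hφP]; exact Subtype.ext heq
      exact hne (congrArg Subtype.val (φ.injective this))
    · intro G' hG' hsub hne'
      have h1 : (⟨G, hG⟩ : faces P) ≤ φ.symm ⟨G', hG'⟩ := by
        rw [OrderIso.le_symm_apply]
        exact hsub
      have h2 := hmax _ (φ.symm ⟨G', hG'⟩).2 h1 (by
        intro heq
        apply hne'
        have : φ.symm ⟨G', hG'⟩ = ⟨P, htopP⟩ := Subtype.ext heq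
        rw [OrderIso.symm_apply_eq, hφP] at this
        exact congrArg Subtype.val this)
      have h3 : φ.symm ⟨G', hG'⟩ = ⟨G, hG⟩ := Subtype.ext h2
      rw [OrderIso.symm_apply_eq] at h3
      exact congrArg Subtype.val h3
  · intro G hG G' hG' heq
    rw [hg G hG.1, hg G' hG'.1] at heq
    exact congrArg Subtype.val (φ.injective (Subtype.ext heq))

theorem stdSimplex_prod_eq (ι κ : Type*) [Fintype ι] [Fintype κ] [DecidableEq ι]
    [DecidableEq κ] : stdSimplex ℝ ι ×ˢ stdSimplex ℝ κ =
      convexHull ℝ (Set.range (prodVertex : ι × κ → (ι → ℝ) × (κ → ℝ))) := by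
  rw [← convexHull_rangle_single_eq_stdSimplex, ← convexHull_rangle_single_eq_stdSimplex,
    ← convexHull_prod, Set.range_prodMap.symm]
  rfl

theorem generated_stdSimplex_prod (ι κ : Type*) [Fintype ι] [Fintype κ] [DecidableEq ι]
    [DecidableEq κ] [Nonempty ι] : Generated (stdSimplex ℝ ι ×ˢ stdSimplex ℝ κ) (ι ⊕ κ) := by
  let h : (ι → ℝ) × (κ → ℝ) →ₗ[ℝ] ℝ := (∑ i, LinearMap.proj i).comp (LinearMap.fst ℝ _ _)
  have h1 : ∀ ij : ι × κ, h (prodVertex ij) = 1 := fun ij => by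
    simp [h, prodVertex, Pi.single_apply]
  have h2 := generated_scaledProd (κ := κ) h fun ij => by simp [h1]
  rw [stdSimplex_prod_eq]
  convert h2 using 2
  simp [scaledProd, h1]

theorem IsTriangularPrism.facets_le {P : Set E} (h : IsTriangularPrism P) :
    (facets P).ncard ≤ 5 := by
  obtain ⟨⟨S, hS, rfl⟩, hc⟩ := h
  have hQ := (generated_stdSimplex_prod (Fin 2) (Fin 3)).maxFaces_le
  have hfin : (maxFaces (convexHull ℝ S)).Finite :=
    (finite_faces_convexHull hS).subset fun G hG => hG.1
  refine (Set.ncard_le_ncard (facets_subset_maxFaces _) hfin).trans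
    ((maxFaces_ncard_le_of_combEquiv hc hQ.1).trans (hQ.2.trans ?_))
  simp

theorem IsTriangularPrism.xc_le {P : Set E} (h : IsTriangularPrism P) (hnt : P.Nontrivial) :
    xc P ≤ 5 := by
  have h5 := h.facets_le
  obtain ⟨⟨S, hS, rfl⟩, -⟩ := h
  have := PolyXC.xc_le hS (generated_facets hS hnt).2 (AffineMap.id ℝ E)
  simp only [AffineMap.coe_id, Set.image_id, Fintype.card_fin] at this
  exact this.trans h5

theorem IsPolytope.finite_vertices {P : Set E} (hP : IsPolytope P) : (vertices P).Finite := by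
  obtain ⟨S, hS, rfl⟩ := hP
  exact hS.subset extremePoints_convexHull_subset

theorem IsPolytope.convexHull_vertices {P : Set E} (hP : IsPolytope P) :
    convexHull ℝ (vertices P) = P := by
  have hfin := hP.finite_vertices
  obtain ⟨S, hS, rfl⟩ := hP
  have h := closure_convexHull_extremePoints (hS.isCompact_convexHull (𝕜 := ℝ))
    (convex_convexHull ℝ S)
  exact (hfin.isClosed_convexHull (𝕜 := ℝ)).closure_eq ▸ h

/-- Start from the prism, with xc at most 5, and add the remaining vertices one at a time: 5 + (v −
6) = v − 1. -/
theorem xc_le_of_prism {P S : Set E} (hP : IsPolytope P) (hS : S ⊆ vertices P)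
    (hcard : S.ncard = 6) (hprism : IsTriangularPrism (convexHull ℝ S)) :
    xc P + 1 ≤ (vertices P).ncard := by
  have hfin := hP.finite_vertices
  have hnt : (convexHull ℝ S).Nontrivial := by
    exact (Set.one_lt_ncard_iff_nontrivial_and_finite.1 (by omega)).1.mono
      (subset_convexHull ℝ S)
  have h1 := xc_union_le hprism.1 hnt (hfin.sdiff (t := S))
  rw [convexHull_convexHull_union_left, Set.union_sdiff_cancel hS, hP.convexHull_vertices] at h1
  have h2 := Set.ncard_sdiff_add_ncard_of_subset hS hfin
  have h3 := hprism.xc_le hnt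
  omega

/-- A common projective point of three lines gives a vector in all three homogenized lines. -/
theorem ConcurrentLines.exists_vector {a b c d e f : E}
    (h : ConcurrentLines (affineSpan ℝ {a, b}) (affineSpan ℝ {c, d}) (affineSpan ℝ {e, f}))
    (hab : a ≠ b) : ∃ X : E × ℝ, X ≠ 0 ∧ (∃ s t : ℝ, X = s • hom a + t • hom b) ∧
      (∃ s t : ℝ, X = s • hom c + t • hom d) ∧ ∃ s t : ℝ, X = s • hom e + t • hom f := by
  rcases h with ⟨x, h1, h2, h3⟩ | ⟨h1, h2⟩
  · have key : ∀ y z : E, x ∈ affineSpan ℝ {y, z} → ∃ s t : ℝ, hom x = s • hom y + t • hom z := by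
      intro y z h
      obtain ⟨r, rfl⟩ := mem_affineSpan_pair_iff_exists_lineMap_eq.1 h
      refine ⟨1 - r, r, ?_⟩
      rw [← hom_combo (by ring), AffineMap.lineMap_apply_module]
    exact ⟨hom x, fun h0 => by simpa using congrArg Prod.snd h0, key _ _ h1, key _ _ h2,
      key _ _ h3⟩
  · have h3 := h1.trans h2
    rw [AffineSubspace.affineSpan_pair_parallel_iff_exists_unit_smul'] at h1 h3
    have key : ∀ (y z : E) (r : ℝ), r • (b - a) = z - y →
        r ≠ 0 → ∃ s t : ℝ, hom b - hom a = s • hom y + t • hom z := by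
      intro y z r h hr
      refine ⟨-r⁻¹, r⁻¹, ?_⟩
      have h' : b - a = r⁻¹ • (z - y) := by rw [← h, smul_smul, inv_mul_cancel₀ hr, one_smul]
      ext1
      · simp only [Prod.fst_sub, hom_fst, h', Prod.fst_add, Prod.smul_fst]; module
      · simp
    obtain ⟨u, hu⟩ := h1
    obtain ⟨v, hv⟩ := h3
    refine ⟨hom b - hom a, fun h0 => hab ?_, ⟨-1, 1, by module⟩, key _ _ u hu u.ne_zero,
      key _ _ v hv v.ne_zero⟩
    exact (hom_injective (sub_eq_zero.1 h0)).symm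

theorem pos_of_mul_eq_mul {u v s t : ℝ} (h : u * s = v * t) (hs : 0 < s) (ht : 0 < t)
    (hu : 0 < u) : 0 < v := by
  have : 0 < v * t := h ▸ mul_pos hu hs
  exact pos_of_mul_pos_left this ht.le

/-- The homogenized vertices of a Desarguian hexagon are, up to scaling, the sums of one of two and
one of three vectors. -/
theorem IsDesarguianHexagon.exists_sums {H : Set E} (h : IsDesarguianHexagon H) :
    ∃ (X : E × ℝ) (B : Fin 3 → E × ℝ) (μ : Fin 2 × Fin 3 → ℝ) (q : Fin 2 × Fin 3 → E),
      (∀ ij, 0 < μ ij) ∧ Set.range q = vertices H ∧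
      ∀ ij : Fin 2 × Fin 3, (if ij.1 = 0 then X else 0) + B ij.2 = μ ij • hom (q ij) := by
  obtain ⟨-, p, ⟨hinj, hrange, hedge⟩, hconc⟩ := h
  have hedge' : ∀ i, ∃ f : E × ℝ →ₗ[ℝ] ℝ, f (hom (p i)) = 0 ∧ f (hom (p (i + 1))) = 0 ∧
      ∀ j, j ≠ i → j ≠ i + 1 → 0 < f (hom (p j)) := by
    intro i
    obtain ⟨f, hf, hseg⟩ := mem_faces_iff.1 (hedge i)
    have h1 : p i ∈ segment ℝ (p i) (p (i + 1)) := left_mem_segment _ _ _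
    have h2 : p (i + 1) ∈ segment ℝ (p i) (p (i + 1)) := right_mem_segment _ _ _
    have hv : ∀ j, p j ∈ vertices H := fun j => hrange ▸ Set.mem_range_self j
    refine ⟨f, (hseg ▸ h1).2, (hseg ▸ h2).2, fun j hj hj' => ?_⟩
    refine lt_of_le_of_ne (hf _ (hv j).1) fun h0 => ?_
    have hmem : p j ∈ segment ℝ (p i) (p (i + 1)) := by
      rw [hseg]; exact ⟨(hv j).1, h0.symm⟩
    rcases (mem_extremePoints_iff_forall_segment.1 (hv j)).2 _ (hv i).1 _ (hv (i + 1)).1 hmem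
      with h3 | h3
    · exact hj (hinj h3).symm
    · exact hj' (hinj h3).symm
  choose g hg hg' hgpos using hedge'
  obtain ⟨X, hX0, ⟨a0, a1, h01⟩, ⟨a5, a2, h52⟩, ⟨a3, a4, h34⟩⟩ :=
    hconc.exists_vector (hinj.ne (by decide))
  -- Evaluating the three expressions for X on the functional of an edge removes the terms of its
  -- two endpoints. The resulting relations fix all signs relative to `a5`: those of p 0, p 5, p 4
  -- agree, those of p 1, p 2, p 3 are opposite.
  have e0 : a5 * g 0 (hom (p 5)) + a2 * g 0 (hom (p 2)) = 0 := by
    have := congrArg (g 0) (h01.symm.trans h52)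
    have h1 := hg' 0
    simp only [map_add, map_smul, smul_eq_mul, hg 0, zero_add] at this h1
    rw [← this, h1]; ring
  have e1 : a0 * g 1 (hom (p 0)) = a5 * g 1 (hom (p 5)) := by
    have := congrArg (g 1) (h01.symm.trans h52)
    have h1 := hg' 1
    rw [show (1 : Fin 6) + 1 = 2 from rfl] at h1
    simpa [hg 1, h1] using this
  have e5 : a1 * g 5 (hom (p 1)) = a2 * g 5 (hom (p 2)) := by
    have := congrArg (g 5) (h01.symm.trans h52)
    have h1 := hg' 5
    rw [show (5 : Fin 6) + 1 = 0 from rfl] at h1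
    simpa [hg 5, h1] using this
  have e4 : a3 * g 4 (hom (p 3)) = a2 * g 4 (hom (p 2)) := by
    have := congrArg (g 4) (h34.symm.trans h52)
    have h1 := hg' 4
    rw [show (4 : Fin 6) + 1 = 5 from rfl] at h1
    simpa [hg 4, h1] using this
  have e2 : a4 * g 2 (hom (p 4)) = a5 * g 2 (hom (p 5)) := by
    have := congrArg (g 2) (h34.symm.trans h52)
    have h1 := hg' 2
    rw [show (2 : Fin 6) + 1 = 3 from rfl] at h1
    simpa [hg 2, h1] using this
  -- Stated for arbitrary coefficients, because replacing X by −X reduces the case of negative `a5`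
  -- to the positive one.
  have key : ∀ (X : E × ℝ) (a0 a1 a2 a3 a4 a5 : ℝ), X = a0 • hom (p 0) + a1 • hom (p 1) →
      X = a5 • hom (p 5) + a2 • hom (p 2) → X = a3 • hom (p 3) + a4 • hom (p 4) →
      a5 * g 0 (hom (p 5)) + a2 * g 0 (hom (p 2)) = 0 →
      a0 * g 1 (hom (p 0)) = a5 * g 1 (hom (p 5)) →
      a1 * g 5 (hom (p 1)) = a2 * g 5 (hom (p 2)) →
      a3 * g 4 (hom (p 3)) = a2 * g 4 (hom (p 2)) →
      a4 * g 2 (hom (p 4)) = a5 * g 2 (hom (p 5)) → 0 < a5 →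
      ∃ (X : E × ℝ) (B : Fin 3 → E × ℝ) (μ : Fin 2 × Fin 3 → ℝ) (q : Fin 2 × Fin 3 → E),
      (∀ ij, 0 < μ ij) ∧ Set.range q = vertices H ∧
      ∀ ij : Fin 2 × Fin 3, (if ij.1 = 0 then X else 0) + B ij.2 = μ ij • hom (q ij) := by
    intro X a0 a1 a2 a3 a4 a5 h01 h52 h34 e0 e1 e5 e4 e2 h5
    have h0 : 0 < a0 := pos_of_mul_eq_mul e1.symm (hgpos 1 5 (by decide) (by decide))
      (hgpos 1 0 (by decide) (by decide)) h5
    have h4 : 0 < a4 := pos_of_mul_eq_mul e2.symm (hgpos 2 5 (by decide) (by decide))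
      (hgpos 2 4 (by decide) (by decide)) h5
    have h2 : 0 < -a2 := pos_of_mul_eq_mul (by linarith) (hgpos 0 5 (by decide) (by decide))
      (hgpos 0 2 (by decide) (by decide)) h5
    have h1 : 0 < -a1 := pos_of_mul_eq_mul (by linarith) (hgpos 5 2 (by decide) (by decide))
      (hgpos 5 1 (by decide) (by decide)) h2
    have h3 : 0 < -a3 := pos_of_mul_eq_mul (by linarith) (hgpos 4 2 (by decide) (by decide))
      (hgpos 4 3 (by decide) (by decide)) h2
    -- Moving the negative terms across gives a0 p 0 = X + (−a1) p 1, and likewise for the pairs 5,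
    -- 2 and 4, 3. So p 1, p 2, p 3 form one triangle and p 0, p 5, p 4 the other.
    refine ⟨X, ![(-a1) • hom (p 1), (-a2) • hom (p 2), (-a3) • hom (p 3)],
      fun ij => ![![a0, a5, a4], ![-a1, -a2, -a3]] ij.1 ij.2,
      fun ij => p (![![0, 5, 4], ![1, 2, 3]] ij.1 ij.2), ?_, ?_, ?_⟩
    · rintro ⟨i, j⟩
      fin_cases i <;> fin_cases j
      exacts [h0, h5, h4, h1, h2, h3]
    · rw [← hrange]
      apply Set.Subset.antisymm
      · rintro _ ⟨ij, rfl⟩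
        exact ⟨_, rfl⟩
      · rintro _ ⟨k, rfl⟩
        fin_cases k
        · exact ⟨(0, 0), rfl⟩
        · exact ⟨(1, 0), rfl⟩
        · exact ⟨(1, 1), rfl⟩
        · exact ⟨(1, 2), rfl⟩
        · exact ⟨(0, 2), rfl⟩
        · exact ⟨(0, 1), rfl⟩
    · rintro ⟨i, j⟩
      fin_cases i <;> fin_cases j
      · simp [h01]
      · simp [h52]
      · simp [h34]
      all_goals simp
  rcases lt_trichotomy a5 0 with h5 | h5 | h5
  · refine key (-X) (-a0) (-a1) (-a2) (-a3) (-a4) (-a5) ?_ ?_ ?_ ?_ ?_ ?_ ?_ ?_ (by linarith)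
    · rw [h01]; module
    · rw [h52]; module
    · rw [h34]; module
    all_goals linarith
  · exfalso
    apply hX0
    rw [h5, zero_mul, zero_add, mul_eq_zero] at e0
    rw [h52, h5, e0.resolve_right (hgpos 0 2 (by decide) (by decide)).ne']
    simp
  · exact key X a0 a1 a2 a3 a4 a5 h01 h52 h34 e0 e1 e5 e4 e2 h5

/-- The linear map sending the unit vectors to X, 0 and the three B j carries the vertices of the
product to positive multiples of the homogenized hexagon vertices. Rescaling by the heights μ turns
this into an affine projection of a scaled prism. -/
theorem IsDesarguianHexagon.xc_le {H : Set E} (h : IsDesarguianHexagon H) : xc H ≤ 5 := by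
  obtain ⟨X, B, μ, q, hμ, hq, hsum⟩ := h.exists_sums
  let ρ : (Fin 2 → ℝ) × (Fin 3 → ℝ) →ₗ[ℝ] E × ℝ :=
    ((LinearMap.toSpanSingleton ℝ (E × ℝ) X).comp (LinearMap.proj 0)).comp (LinearMap.fst ℝ _ _) +
      (Fintype.linearCombination ℝ B).comp (LinearMap.snd ℝ _ _)
  have hρ : ∀ ij : Fin 2 × Fin 3, ρ (prodVertex ij) = μ ij • hom (q ij) := by
    intro ij
    rw [← hsum]
    simp [ρ, prodVertex, Pi.single_apply, eq_comm]
  have hh : ∀ ij : Fin 2 × Fin 3, ((LinearMap.snd ℝ E ℝ).comp ρ) (prodVertex ij) = μ ij := by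
    intro ij
    rw [LinearMap.comp_apply, hρ]
    simp
  have h1 := PolyXC.xc_le (Set.finite_range _) (generated_scaledProd ((LinearMap.snd ℝ E ℝ).comp ρ)
    (fun ij => by rw [hh]; exact hμ ij)) ((LinearMap.fst ℝ E ℝ).comp ρ).toAffineMap
  have h2 : ((LinearMap.fst ℝ E ℝ).comp ρ).toAffineMap ''
      convexHull ℝ (scaledProd ((LinearMap.snd ℝ E ℝ).comp ρ)) = H := by
    rw [AffineMap.image_convexHull, ← h.1.1.convexHull_vertices, ← hq, scaledProd,
      ← Set.range_comp]
    congr 2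
    ext1 ij
    rw [Function.comp_apply, hh, LinearMap.coe_toAffineMap, map_smul, LinearMap.comp_apply, hρ]
    simp [smul_smul, (hμ ij).ne']
  have h3 := h1
  unfold scaledProd at h2
  rw [h2] at h3
  simpa using h3

end UpperBounds

/-! ### The slack cone of an extension -/

section Slack

variable {E F : Type*} [NormedAddCommGroup E] [NormedSpace ℝ E] [FiniteDimensional ℝ E]
  [NormedAddCommGroup F] [NormedSpace ℝ F] [FiniteDimensional ℝ F]
  {ι : Type*} [Fintype ι]

/-- The cone over `P` is the image under `ρ` of the nonnegative vectors of `L`, and the affine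
functions nonnegative on `P` come from nonnegative vectors. -/
structure IsSlackRep (P : Set E) (L : Submodule ℝ (ι → ℝ)) (ρ : (ι → ℝ) →ₗ[ℝ] E × ℝ) :
    Prop where
  map_eq : L.map ρ = homSpan P
  mem : ∀ z ∈ L, 0 ≤ z → ∃ t : ℝ, 0 ≤ t ∧ ∃ x ∈ P, ρ z = t • hom x
  lift : ∀ x ∈ P, ∃ z ∈ L, 0 ≤ z ∧ ρ z = hom x
  farkas : ∀ f : E × ℝ →ₗ[ℝ] ℝ, NonnegOn f P →
    ∃ c : ι → ℝ, 0 ≤ c ∧ ∀ z ∈ L, f (ρ z) = dotProduct c z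

theorem exists_nonneg_add_snd {S : Set F} (hS : S.Finite) (f : F × ℝ →ₗ[ℝ] ℝ) :
    ∃ C : ℝ, NonnegOn (f + C • LinearMap.snd ℝ F ℝ) (convexHull ℝ S) := by
  obtain ⟨C, hC⟩ := (hS.image fun s => -f (hom s)).bddAbove
  refine ⟨C, NonnegOn.convexHull fun s hs => ?_⟩
  have := hC ⟨s, hs, rfl⟩
  simp at this ⊢
  linarith

/-- L is the image of the span of the homogenized Q under the generating functionals. On this span
the slack map is injective because Q is bounded, so a left inverse followed by the homogenized
projection serves as ρ. -/
theorem exists_isSlackRep {S : Set F} (hS : S.Finite) (hne : S.Nonempty)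
    (h : Generated (convexHull ℝ S) ι) (π : F →ᵃ[ℝ] E) :
    ∃ L ρ, IsSlackRep (ι := ι) (π '' convexHull ℝ S) L ρ := by
  obtain ⟨l, hl, hgen⟩ := h
  set Q := convexHull ℝ S with hQ
  let σ₀ : F × ℝ →ₗ[ℝ] (ι → ℝ) := LinearMap.pi l
  let σ := σ₀.domRestrict (homSpan Q)
  have hdot : ∀ (c : ι → ℝ) v, dotProduct c (σ₀ v) = ∑ i, c i * l i v := fun c v => rfl
  have hcoef : ∀ f, NonnegOn f Q → ∃ c : ι → ℝ, 0 ≤ c ∧ ∀ v ∈ homSpan Q,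
      f v = dotProduct c (σ₀ v) := by
    intro f hf
    obtain ⟨c, hc, hfc⟩ := hgen f hf
    refine ⟨c, hc, fun v hv => ?_⟩
    have := eq_on_homSpan (f := f) (g := ∑ i, c i • l i)
      (fun y hy => by rw [hfc y hy]; simp) hv
    rw [this, hdot]
    simp
  have hpos : ∀ v ∈ homSpan Q, 0 ≤ σ₀ v → ∀ f, NonnegOn f Q → 0 ≤ f v := by
    intro v hv hv0 f hf
    obtain ⟨c, hc, hfc⟩ := hcoef f hf
    rw [hfc v hv]
    exact dotProduct_nonneg_of_nonneg hc hv0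
  have hsnd : NonnegOn (LinearMap.snd ℝ F ℝ) Q := fun x _ => by simp
  -- Boundedness: every functional becomes nonnegative on Q after adding a multiple of the height,
  -- which does not change its value at height 0. So f and −f are both nonnegative at v.
  have hzero : ∀ v ∈ homSpan Q, 0 ≤ σ₀ v → v.2 = 0 → v = 0 := by
    intro v hv hv0 h2
    rw [← Module.forall_dual_apply_eq_zero_iff ℝ]
    have key : ∀ f : F × ℝ →ₗ[ℝ] ℝ, 0 ≤ f v := by
      intro f
      obtain ⟨C, hC⟩ := exists_nonneg_add_snd hS f
      have := hpos v hv hv0 _ hC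
      simpa [h2] using this
    intro f
    refine le_antisymm ?_ (key f)
    simpa using key (-f)
  have hinj : LinearMap.ker σ = ⊥ := by
    rw [LinearMap.ker_eq_bot']
    rintro ⟨v, hv⟩ h0
    have h0' : σ₀ v = 0 := h0
    refine Subtype.ext (hzero v hv h0'.ge (le_antisymm ?_ (hpos v hv h0'.ge _ hsnd)))
    obtain ⟨c, -, hfc⟩ := hcoef _ hsnd
    have := hfc v hv
    rw [h0', dotProduct_zero] at this
    exact this.le
  obtain ⟨κ, hκ⟩ := LinearMap.exists_leftInverse_of_injective σ hinj
  have hκ' : ∀ (v : F × ℝ) (hv : v ∈ homSpan Q), (κ (σ₀ v) : F × ℝ) = v := fun v hv =>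
    congrArg Subtype.val (LinearMap.congr_fun hκ ⟨v, hv⟩)
  let ρ : (ι → ℝ) →ₗ[ℝ] E × ℝ := (homMap π).comp ((homSpan Q).subtype.comp κ)
  have hρ : ∀ v ∈ homSpan Q, ρ (σ₀ v) = homMap π v := by
    intro v hv
    simp only [ρ, LinearMap.comp_apply, Submodule.subtype_apply, hκ' v hv]
  have hQne : Q.Nonempty := hne.convexHull
  refine ⟨(homSpan Q).map σ₀, ρ, ?_, ?_, ?_, ?_⟩
  · apply le_antisymm
    · rintro _ ⟨_, ⟨v, hv, rfl⟩, rfl⟩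
      rw [hρ v hv]
      have : homSpan Q ≤ (homSpan (π '' Q)).comap (homMap π) := by
        refine Submodule.span_le.2 ?_
        rintro _ ⟨x, hx, rfl⟩
        simpa using hom_mem_homSpan (Set.mem_image_of_mem π hx)
      exact this hv
    · refine Submodule.span_le.2 ?_
      rintro _ ⟨_, ⟨x, hx, rfl⟩, rfl⟩
      exact ⟨σ₀ (hom x), ⟨hom x, hom_mem_homSpan hx, rfl⟩, by
        rw [hρ _ (hom_mem_homSpan hx), homMap_hom]⟩
  · rintro _ ⟨v, hv, rfl⟩ hv0
    have ht := hpos v hv hv0 _ hsnd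
    rw [hρ v hv]
    rcases ht.eq_or_lt with ht | ht
    · obtain ⟨x, hx⟩ := hQne
      exact ⟨0, le_rfl, π x, ⟨x, hx, rfl⟩, by rw [hzero v hv hv0 ht.symm]; simp⟩
    · have ht' : 0 < v.2 := ht
      have hvx : v = v.2 • hom (v.2⁻¹ • v.1) := by
        ext1
        · simp [smul_smul, ht'.ne']
        · simp
      -- A hyperplane separating this point from Q would be a functional nonnegative on Q and
      -- negative at v.
      have hx : v.2⁻¹ • v.1 ∈ Q := by
        by_contra hcon
        obtain ⟨f, u, hfu, hfQ⟩ := geometric_hahn_banach_point_closed (convex_convexHull ℝ S)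
          (hS.isCompact_convexHull (𝕜 := ℝ)).isClosed hcon
        have := hpos v hv hv0 ((f : F →ₗ[ℝ] ℝ).comp (LinearMap.fst ℝ F ℝ) -
          u • LinearMap.snd ℝ F ℝ) (fun x hx => by simpa using (hfQ x hx).le)
        rw [hvx, map_smul, smul_eq_mul] at this
        have h3 := nonneg_of_mul_nonneg_right this ht'
        simp only [LinearMap.sub_apply, LinearMap.comp_apply, LinearMap.fst_apply, hom_fst,
          ContinuousLinearMap.coe_coe, LinearMap.smul_apply, LinearMap.snd_apply, hom_snd,
          smul_eq_mul, mul_one] at h3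
        linarith
      refine ⟨v.2, ht'.le, _, ⟨_, hx, rfl⟩, ?_⟩
      rw [← homMap_hom, ← map_smul, ← hvx]
  · rintro _ ⟨x, hx, rfl⟩
    refine ⟨σ₀ (hom x), ⟨hom x, hom_mem_homSpan hx, rfl⟩, fun i => hl i x hx, ?_⟩
    rw [hρ _ (hom_mem_homSpan hx), homMap_hom]
  · intro f hf
    obtain ⟨c, hc, hfc⟩ := hcoef (f.comp (homMap π)) fun x hx => by
      simpa using hf _ ⟨x, hx, rfl⟩
    refine ⟨c, hc, ?_⟩
    rintro _ ⟨v, hv, rfl⟩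
    rw [hρ v hv, ← hfc v hv]
    rfl

/-- A linear functional vanishing on the kernel of `ρ` factors through `ρ`. -/
theorem exists_factor {V W : Type*} [AddCommGroup V] [Module ℝ V] [AddCommGroup W] [Module ℝ W]
    [FiniteDimensional ℝ V] (L : Submodule ℝ V) (ρ : V →ₗ[ℝ] W) (φ : V →ₗ[ℝ] ℝ)
    (h : ∀ z ∈ L, ρ z = 0 → φ z = 0) : ∃ ψ : W →ₗ[ℝ] ℝ, ∀ z ∈ L, ψ (ρ z) = φ z := by
  have h1 : φ.domRestrict L ∈ LinearMap.range (ρ.domRestrict L).dualMap := by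
    rw [LinearMap.range_dualMap_eq_dualAnnihilator_ker, Submodule.mem_dualAnnihilator]
    rintro ⟨z, hz⟩ h0
    exact h z hz h0
  obtain ⟨ψ, hψ⟩ := h1
  exact ⟨ψ, fun z hz => LinearMap.congr_fun hψ ⟨z, hz⟩⟩

/-- The functional given by a vector. -/
def dotLin (c : ι → ℝ) : (ι → ℝ) →ₗ[ℝ] ℝ := Fintype.linearCombination ℝ c

theorem dotLin_apply (c z : ι → ℝ) : dotLin c z = dotProduct c z := by
  simp [dotLin, Fintype.linearCombination_apply, dotProduct, mul_comm]

/-- A vector that annihilates the kernel of ρ on L descends to a functional on the target. Hence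
generators of the nonnegative annihilating vectors give generators of the functions nonnegative on
P. -/
theorem IsSlackRep.generated {P : Set E} {L : Submodule ℝ (ι → ℝ)} {ρ : (ι → ℝ) →ₗ[ℝ] E × ℝ}
    (h : IsSlackRep P L ρ) {G : Type*} [Fintype G] (y : G → ι → ℝ) (hy : ∀ g, 0 ≤ y g)
    (hker : ∀ g, ∀ z ∈ L, ρ z = 0 → dotProduct (y g) z = 0)
    (hgen : ∀ c : ι → ℝ, 0 ≤ c → (∀ z ∈ L, ρ z = 0 → dotProduct c z = 0) →
      ∃ a : G → ℝ, (∀ g, 0 ≤ a g) ∧ c = ∑ g, a g • y g) : Generated P G := by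
  have hex : ∀ g, ∃ ψ : E × ℝ →ₗ[ℝ] ℝ, ∀ z ∈ L, ψ (ρ z) = dotProduct (y g) z := by
    intro g
    obtain ⟨ψ, hψ⟩ := exists_factor L ρ (dotLin (y g)) fun z hz h0 => by
      rw [dotLin_apply, hker g z hz h0]
    exact ⟨ψ, fun z hz => by rw [hψ z hz, dotLin_apply]⟩
  choose ψ hψ using hex
  refine ⟨ψ, ?_, ?_⟩
  · intro g x hx
    obtain ⟨z, hz, hz0, hzx⟩ := h.lift x hx
    rw [← hzx, hψ g z hz]
    exact dotProduct_nonneg_of_nonneg (hy g) hz0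
  · intro f hf
    obtain ⟨c, hc, hfc⟩ := h.farkas f hf
    obtain ⟨a, ha, hca⟩ := hgen c hc fun z hz h0 => by rw [← hfc z hz, h0, map_zero]
    refine ⟨a, ha, fun x hx => ?_⟩
    obtain ⟨z, hz, -, hzx⟩ := h.lift x hx
    rw [← hzx, hfc z hz, hca, sum_dotProduct]
    exact Finset.sum_congr rfl fun g _ => by rw [smul_dotProduct, hψ g z hz, smul_eq_mul]

theorem eq_convexHull_range {P : Set E} (hP : Convex ℝ P) {G : Type*} [Fintype G] (x : G → E)
    (t : G → ℝ) (hx : ∀ g, x g ∈ P) (ht : ∀ g, 0 ≤ t g)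
    (hgen : ∀ p ∈ P, ∃ c : G → ℝ, (∀ g, 0 ≤ c g) ∧ hom p = ∑ g, c g • t g • hom (x g)) :
    P = convexHull ℝ (Set.range x) := by
  apply Set.Subset.antisymm
  · intro p hp
    obtain ⟨c, hc, hpc⟩ := hgen p hp
    have h1 := congrArg Prod.fst hpc
    have h2 := congrArg Prod.snd hpc
    simp only [Prod.fst_sum, Prod.snd_sum, Prod.smul_fst, Prod.smul_snd, hom_fst, hom_snd,
      smul_eq_mul, mul_one, smul_smul] at h1 h2
    rw [h1]
    exact (convex_convexHull ℝ _).sum_mem (fun g _ => mul_nonneg (hc g) (ht g)) h2.symm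
      fun g _ => subset_convexHull _ _ ⟨g, rfl⟩
  · refine convexHull_min ?_ hP
    rintro _ ⟨g, rfl⟩
    exact hx g

theorem IsSlackRep.exists_points {P : Set E} (hP : Convex ℝ P) {L : Submodule ℝ (ι → ℝ)}
    {ρ : (ι → ℝ) →ₗ[ℝ] E × ℝ}
    (h : IsSlackRep P L ρ) {G : Type*} [Fintype G] (y : G → ι → ℝ) (hy : ∀ g, 0 ≤ y g)
    (hyL : ∀ g, y g ∈ L)
    (hgen : ∀ c : ι → ℝ, 0 ≤ c → c ∈ L → ∃ a : G → ℝ, (∀ g, 0 ≤ a g) ∧ c = ∑ g, a g • y g) :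
    ∃ (x : G → E) (t : G → ℝ), (∀ g, x g ∈ P) ∧ (∀ g, 0 ≤ t g) ∧
      (∀ g, ρ (y g) = t g • hom (x g)) ∧ P = convexHull ℝ (Set.range x) := by
  choose t ht x hx hρ using fun g => h.mem (y g) (hyL g) (hy g)
  refine ⟨x, t, hx, ht, hρ, eq_convexHull_range hP x t hx ht fun p hp => ?_⟩
  obtain ⟨z, hz, hz0, hzp⟩ := h.lift p hp
  obtain ⟨a, ha, hza⟩ := hgen z hz0 hz
  refine ⟨a, ha, ?_⟩
  rw [← hzp, hza, map_sum]
  exact Finset.sum_congr rfl fun g _ => by rw [map_smul, hρ]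

end Slack

/-! ### Nonnegative vectors in a hyperplane -/

section Generators

variable {ι : Type*} [Fintype ι] [DecidableEq ι]

/-- The index type of the extreme rays of the cone of nonnegative vectors orthogonal to `w`. -/
abbrev Gens (w : ι → ℝ) : Type _ := {c // w c = 0} ⊕ ({i // 0 < w i} × {j // w j < 0})

/-- The extreme rays of the cone of nonnegative vectors orthogonal to `w`. -/
def genVec (w : ι → ℝ) : Gens w → ι → ℝ
  | .inl c => Pi.single (c : ι) 1
  | .inr ij => Pi.single (ij.1 : ι) (-w ij.2) + Pi.single (ij.2 : ι) (w ij.1)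

theorem genVec_nonneg (w : ι → ℝ) (g : Gens w) : 0 ≤ genVec w g := by
  rcases g with c | ⟨i, j⟩
  · exact Pi.single_nonneg.2 zero_le_one
  · exact add_nonneg (Pi.single_nonneg.2 (neg_nonneg.2 j.2.le)) (Pi.single_nonneg.2 i.2.le)

theorem dotProduct_genVec (w : ι → ℝ) (g : Gens w) : dotProduct w (genVec w g) = 0 := by
  rcases g with c | ⟨i, j⟩
  · simp [genVec, c.2]
  · simp [genVec]; ring

theorem sum_eq_pos_add_neg_add_zero {M : Type*} [AddCommMonoid M] (w : ι → ℝ) (f : ι → M) :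
    ∑ i, f i = (∑ i : {i // 0 < w i}, f i) + (∑ j : {j // w j < 0}, f j) +
      ∑ c : {c // w c = 0}, f c := by
  have key : ∀ (p : ι → Prop) [DecidablePred p],
      ∑ i : {i // p i}, f i = ∑ i, if p i then f i else 0 := by
    intro p _
    rw [← Finset.sum_filter]
    exact (Finset.sum_subtype _ (by simp) f).symm
  rw [key, key, key, ← Finset.sum_add_distrib, ← Finset.sum_add_distrib]
  refine Finset.sum_congr rfl fun i _ => ?_
  rcases lt_trichotomy (w i) 0 with h | h | h
  · simp [h, h.ne, h.not_gt]
  · simp [h]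
  · simp [h, h.ne', h.not_gt]

theorem dotProduct_eq_pos_sub_neg (w z : ι → ℝ) : dotProduct w z =
    (∑ i : {i // 0 < w i}, w i * z i) - ∑ j : {j // w j < 0}, -w j * z j := by
  have h0 : ∑ c : {c // w c = 0}, w c * z c = 0 :=
    Finset.sum_eq_zero fun c _ => by rw [c.2, zero_mul]
  rw [dotProduct, sum_eq_pos_add_neg_add_zero w, h0]
  simp

/-- A transport problem: the positive part of w · z equals the negative part, with common value M,
and the product coupling z i z j / M distributes it over the pairs. -/
theorem exists_combination (w z : ι → ℝ) (hz : 0 ≤ z) (hwz : dotProduct w z = 0) :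
    ∃ a : Gens w → ℝ, (∀ g, 0 ≤ a g) ∧ z = ∑ g, a g • genVec w g := by
  set M := ∑ i : {i // 0 < w i}, w i * z i with hM
  have hM' : ∑ j : {j // w j < 0}, -w j * z j = M := by
    rw [dotProduct_eq_pos_sub_neg] at hwz; linarith
  have hMpos : ∀ i : {i // 0 < w i}, 0 ≤ w i * z i := fun i => mul_nonneg i.2.le (hz i)
  have hMneg : ∀ j : {j // w j < 0}, 0 ≤ -w j * z j := fun j =>
    mul_nonneg (neg_nonneg.2 j.2.le) (hz j)
  have hM0 : 0 ≤ M := Finset.sum_nonneg fun i _ => hMpos i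
  refine ⟨Sum.elim (fun c => z c) (fun ij => z ij.1 * z ij.2 / M), ?_, ?_⟩
  · rintro (c | ⟨i, j⟩)
    · exact hz c
    · exact div_nonneg (mul_nonneg (hz i) (hz j)) hM0
  · ext k
    rw [Finset.sum_apply, Fintype.sum_sum_type, Fintype.sum_prod_type]
    simp only [Pi.smul_apply, smul_eq_mul, Sum.elim_inl, Sum.elim_inr, genVec, Pi.add_apply,
      Pi.single_apply]
    rcases lt_trichotomy (w k) 0 with hk | hk | hk
    · have h1 : ∀ c : {c // w c = 0}, k ≠ c := fun c h => by have := c.2; rw [← h] at this; linarith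
      have h2 : ∀ c : {c // 0 < w c}, k ≠ c := fun c h => by have := c.2; rw [← h] at this; linarith
      have h3 : ∀ j : {j // w j < 0}, k = j ↔ j = ⟨k, hk⟩ := fun j => by
        rw [Subtype.ext_iff]; exact eq_comm
      simp only [h1, h2, h3, if_false, mul_zero, Finset.sum_const_zero, zero_add, mul_ite,
        Finset.sum_ite_eq', Finset.mem_univ, if_true]
      have : ∀ i : {i // 0 < w i}, z i * z k / M * w i = z k / M * (w i * z i) := fun i => by ring
      rw [Finset.sum_congr rfl fun i _ => this i, ← Finset.mul_sum, ← hM]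
      -- When M = 0, all entries of z at nonzero entries of w vanish, so division by zero returning
      -- 0 does no harm.
      rcases hM0.eq_or_lt with h0 | h0
      · rw [← h0] at hM'
        have h4 := (Finset.sum_eq_zero_iff_of_nonneg fun j _ => hMneg j).1 hM' ⟨k, hk⟩
          (Finset.mem_univ _)
        rw [(mul_eq_zero.1 h4).resolve_left (by simpa using hk.ne)]
        simp
      · field_simp
    · have h1 : ∀ c : {c // w c < 0}, k ≠ c := fun c h => by have := c.2; rw [← h] at this; linarith
      have h2 : ∀ c : {c // 0 < w c}, k ≠ c := fun c h => by have := c.2; rw [← h] at this; linarith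
      have h3 : ∀ j : {j // w j = 0}, k = j ↔ j = ⟨k, hk⟩ := fun j => by
        rw [Subtype.ext_iff]; exact eq_comm
      simp [h1, h2, h3]
    · have h1 : ∀ c : {c // w c = 0}, k ≠ c := fun c h => by have := c.2; rw [← h] at this; linarith
      have h2 : ∀ c : {c // w c < 0}, k ≠ c := fun c h => by have := c.2; rw [← h] at this; linarith
      have h3 : ∀ j : {j // 0 < w j}, k = j ↔ j = ⟨k, hk⟩ := fun j => by
        rw [Subtype.ext_iff]; exact eq_comm
      rw [Finset.sum_comm]
      simp only [h1, h2, h3, if_false, mul_zero, Finset.sum_const_zero, zero_add, add_zero,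
        mul_ite, Finset.sum_ite_eq', Finset.mem_univ, if_true]
      have : ∀ j : {i // w i < 0}, z k * z j / M * -w j = z k / M * (-w j * z j) := fun i => by ring
      rw [Finset.sum_congr rfl fun i _ => this i, ← Finset.mul_sum, hM']
      rcases hM0.eq_or_lt with h0 | h0
      · have h4 := (Finset.sum_eq_zero_iff_of_nonneg fun j _ => hMpos j).1 h0.symm ⟨k, hk⟩
          (Finset.mem_univ _)
        rw [(mul_eq_zero.1 h4).resolve_left hk.ne']
        simp
      · field_simp

theorem card_eq_pos_add_neg_add_zero (w : ι → ℝ) : Fintype.card ι =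
    Fintype.card {i // 0 < w i} + Fintype.card {j // w j < 0} + Fintype.card {c // w c = 0} := by
  simpa using sum_eq_pos_add_neg_add_zero w fun _ => (1 : ℕ)

end Generators

/-! ### Reduction to a hyperplane section projected along a line -/

section Projection

variable {E : Type*} [NormedAddCommGroup E] [NormedSpace ℝ E] [FiniteDimensional ℝ E]
  {ι : Type*} [Fintype ι] [DecidableEq ι]

/-- The hyperplane orthogonal to a vector. -/
def orth (w : ι → ℝ) : Submodule ℝ (ι → ℝ) := LinearMap.ker (dotLin w)

theorem mem_orth {w z : ι → ℝ} : z ∈ orth w ↔ dotProduct w z = 0 := by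
  rw [orth, LinearMap.mem_ker, dotLin_apply]

theorem dotLin_single (φ : (ι → ℝ) →ₗ[ℝ] ℝ) : dotLin (fun i => φ (Pi.single i 1)) = φ := by
  ext i
  simp [dotLin_apply]

/-- The cone over `P` is the projection along `r` of the nonnegative vectors orthogonal to `w`. -/
structure IsProjection (P : Set E) (w r : ι → ℝ) (ρ : (ι → ℝ) →ₗ[ℝ] E × ℝ) : Prop where
  convex : Convex ℝ P
  rep : IsSlackRep P (orth w) ρ
  rel : dotProduct w r = 0
  ker : ∀ z, dotProduct w z = 0 → (ρ z = 0 ↔ ∃ τ : ℝ, z = τ • r)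

theorem ncard_range_le {G X : Type*} [Fintype G] (x : G → X) :
    (Set.range x).ncard ≤ Fintype.card G := by
  rw [← Set.image_univ]
  refine (Set.ncard_image_le Set.finite_univ).trans ?_
  rw [Set.ncard_univ, Nat.card_eq_fintype_card]

theorem vertices_ncard_le {P : Set E} {G : Type*} [Fintype G] {x : G → E}
    (h : P = convexHull ℝ (Set.range x)) : (vertices P).ncard ≤ Fintype.card G := by
  refine (Set.ncard_le_ncard ?_ (Set.finite_range x)).trans (ncard_range_le x)
  rw [h]
  exact extremePoints_convexHull_subset

theorem IsSlackRep.vertices_le_of_top {P : Set E} {ρ : (ι → ℝ) →ₗ[ℝ] E × ℝ}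
    (h : IsSlackRep P ⊤ ρ) (hP : Convex ℝ P) : (vertices P).ncard ≤ Fintype.card ι := by
  obtain ⟨x, -, -, -, -, hx⟩ := h.exists_points hP (fun i : ι => Pi.single i 1)
    (fun i => Pi.single_nonneg.2 zero_le_one) (fun _ => Submodule.mem_top)
    (fun c hc _ => ⟨c, hc, by simpa using (pi_eq_sum_univ' c)⟩)
  exact vertices_ncard_le hx

theorem IsSlackRep.facets_le_of_injective {P : Set E} {L : Submodule ℝ (ι → ℝ)}
    {ρ : (ι → ℝ) →ₗ[ℝ] E × ℝ} (h : IsSlackRep P L ρ) (hinj : ∀ z ∈ L, ρ z = 0 → z = 0) :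
    (facets P).ncard ≤ Fintype.card ι := by
  refine (h.generated (fun i : ι => Pi.single i 1)
    (fun i => Pi.single_nonneg.2 zero_le_one) (fun i z hz h0 => by simp [hinj z hz h0])
    (fun c hc _ => ⟨c, hc, by simpa using (pi_eq_sum_univ' c)⟩)).facets_le

theorem exists_generator_of_finrank_eq_one {V : Type*} [AddCommGroup V] [Module ℝ V]
    {K : Submodule ℝ V} (h : Module.finrank ℝ K = 1) : ∃ v ∈ K, ∀ z ∈ K, ∃ c : ℝ, c • v = z := by
  obtain ⟨v, -, hv⟩ := finrank_eq_one_iff'.1 h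
  refine ⟨v, v.2, fun z hz => ?_⟩
  obtain ⟨c, hc⟩ := hv ⟨z, hz⟩
  exact ⟨c, congrArg Subtype.val hc⟩

/-- Too many vertices forbid L = ⊤ and too many facets forbid injectivity of ρ on L. Since dim L =
dim P + 1 + dim ker, this gives card ι ≥ dim P + 3, and equality leaves codimension one and a
one-dimensional kernel. -/
theorem IsSlackRep.isProjection_or {P : Set E} (hne : P.Nonempty) (hP : Convex ℝ P)
    {L : Submodule ℝ (ι → ℝ)} {ρ : (ι → ℝ) →ₗ[ℝ] E × ℝ} (h : IsSlackRep P L ρ)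
    (hv : Fintype.card ι < (vertices P).ncard) (hf : Fintype.card ι < (facets P).ncard) :
    dim P + 3 ≤ Fintype.card ι ∧
      (Fintype.card ι = dim P + 3 → ∃ w r, IsProjection P w r ρ) := by
  have h1 : L ≠ ⊤ := by
    rintro rfl
    exact absurd (h.vertices_le_of_top hP) (by omega)
  have h2 : LinearMap.ker (ρ.domRestrict L) ≠ ⊥ := by
    intro h0
    refine absurd (h.facets_le_of_injective fun z hz hz0 => ?_) (by omega)
    exact congrArg Subtype.val (LinearMap.ker_eq_bot'.1 h0 ⟨z, hz⟩ hz0)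
  have h3 := LinearMap.finrank_range_add_finrank_ker (ρ.domRestrict L)
  have h4 : LinearMap.range (ρ.domRestrict L) = homSpan P := by
    rw [← h.map_eq]
    ext v
    simp only [LinearMap.mem_range, Submodule.mem_map]
    exact ⟨fun ⟨z, hz⟩ => ⟨z, z.2, hz⟩, fun ⟨z, hz, hzv⟩ => ⟨⟨z, hz⟩, hzv⟩⟩
  rw [h4, finrank_homSpan hne] at h3
  have h5 : 1 ≤ Module.finrank ℝ (LinearMap.ker (ρ.domRestrict L)) :=
    Submodule.one_le_finrank_iff.2 h2
  have h6 : Module.finrank ℝ L < Fintype.card ι := by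
    have := Submodule.finrank_lt h1
    rwa [Module.finrank_fintype_fun_eq_card] at this
  refine ⟨by omega, fun hcard => ?_⟩
  have h7 : Module.finrank ℝ (LinearMap.ker (ρ.domRestrict L)) = 1 := by omega
  obtain ⟨φ, hφ, hLφ⟩ := Submodule.exists_le_ker_of_lt_top L (lt_top_iff_ne_top.2 h1)
  have hL : L = orth (fun i => φ (Pi.single i 1)) := by
    rw [orth, dotLin_single]
    refine Submodule.eq_of_le_of_finrank_le hLφ ?_
    obtain ⟨v, hv⟩ : ∃ v, φ v ≠ 0 := by
      by_contra! hcon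
      exact hφ (LinearMap.ext hcon)
    have := finrank_inf_ker (W := ⊤) (f := φ) (Submodule.mem_top (x := v)) hv
    rw [top_inf_eq, finrank_top, Module.finrank_fintype_fun_eq_card] at this
    omega
  obtain ⟨⟨r, hrL⟩, hr, hspan⟩ := exists_generator_of_finrank_eq_one h7
  subst hL
  refine ⟨_, r, hP, h, mem_orth.1 hrL, fun z hz => ⟨fun h0 => ?_, ?_⟩⟩
  · obtain ⟨τ, hτ⟩ := hspan ⟨z, mem_orth.2 hz⟩ h0
    exact ⟨τ, (congrArg Subtype.val hτ).symm⟩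
  · rintro ⟨τ, rfl⟩
    have : ρ r = 0 := hr
    rw [map_smul, this, smul_zero]

theorem xc_lower {P : Set E} (hP : IsPolytope P) (hnt : P.Nontrivial)
    (hv : dim P + 4 ≤ (vertices P).ncard) (hf : dim P + 4 ≤ (facets P).ncard) :
    dim P + 3 ≤ xc P ∧ (xc P = dim P + 3 → ∃ (w r : Fin (dim P + 3) → ℝ)
      (ρ : (Fin (dim P + 3) → ℝ) →ₗ[ℝ] E × ℝ), IsProjection P w r ρ) := by
  obtain ⟨m, S, π, hS, hπ, hgen⟩ := exists_generated_extension hP hnt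
  have hne : S.Nonempty := by
    have := hnt.nonempty
    rw [← hπ] at this
    exact convexHull_nonempty_iff.1 this.of_image
  obtain ⟨L, ρ, hrep⟩ := exists_isSlackRep hS hne hgen π
  rw [hπ] at hrep
  have hconv : Convex ℝ P := by
    obtain ⟨S, -, rfl⟩ := hP
    exact convex_convexHull ℝ S
  by_cases hle : xc P ≤ dim P + 3
  · obtain ⟨h1, h2⟩ := hrep.isProjection_or hnt.nonempty hconv (by simp; omega) (by simp; omega)
    rw [Fintype.card_fin] at h1 h2
    refine ⟨h1, fun heq => ?_⟩
    obtain ⟨w, r, h3⟩ := h2 heq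
    rw [← heq]
    exact ⟨w, r, ρ, h3⟩
  · exact ⟨by omega, fun h => by omega⟩

end Projection

/-! ### Counting vertices and facets through signs of w and r -/

section Counting

variable {E : Type*} [NormedAddCommGroup E] [NormedSpace ℝ E] [FiniteDimensional ℝ E]
  {ι : Type*} [Fintype ι] [DecidableEq ι] {P : Set E} {w r : ι → ℝ}
  {ρ : (ι → ℝ) →ₗ[ℝ] E × ℝ}

theorem orth_neg (w : ι → ℝ) : orth (-w) = orth w := by
  ext z
  simp [mem_orth]

theorem IsProjection.neg_left (h : IsProjection P w r ρ) : IsProjection P (-w) r ρ where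
  convex := h.convex
  rep := by rw [orth_neg]; exact h.rep
  rel := by simp [h.rel]
  ker z hz := h.ker z (by simpa using hz)

theorem IsProjection.neg_right (h : IsProjection P w r ρ) : IsProjection P w (-r) ρ where
  convex := h.convex
  rep := h.rep
  rel := by simp [h.rel]
  ker z hz := by
    rw [h.ker z hz]
    constructor
    · rintro ⟨τ, rfl⟩
      exact ⟨-τ, by simp⟩
    · rintro ⟨τ, rfl⟩
      exact ⟨-τ, by simp⟩

theorem IsProjection.map_rel (h : IsProjection P w r ρ) : ρ r = 0 :=
  (h.ker r h.rel).2 ⟨1, (one_smul ℝ r).symm⟩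

/-- Dually to the vertices, functions nonnegative on P come from nonnegative vectors orthogonal to
r, so r counts facets as w counts vertices. -/
theorem IsProjection.facets_le (h : IsProjection P w r ρ) :
    (facets P).ncard ≤ Fintype.card (Gens r) := by
  refine (h.rep.generated (genVec r) (genVec_nonneg r) ?_ ?_).facets_le
  · intro g z hz h0
    obtain ⟨τ, rfl⟩ := (h.ker z (mem_orth.1 hz)).1 h0
    rw [dotProduct_smul, dotProduct_comm, dotProduct_genVec, smul_zero]
  · intro c hc hcr
    refine exists_combination r c hc ?_
    rw [dotProduct_comm]
    exact hcr r (mem_orth.2 h.rel) h.map_rel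

/-- The points of `P` on the images of the generators. -/
structure IsGenPoints (P : Set E) (w : ι → ℝ) (ρ : (ι → ℝ) →ₗ[ℝ] E × ℝ) (x : Gens w → E)
    (t : Gens w → ℝ) : Prop where
  mem : ∀ g, x g ∈ P
  nonneg : ∀ g, 0 ≤ t g
  map : ∀ g, ρ (genVec w g) = t g • hom (x g)
  hull : P = convexHull ℝ (Set.range x)

theorem IsProjection.exists_genPoints (h : IsProjection P w r ρ) :
    ∃ x t, IsGenPoints P w ρ x t := by
  obtain ⟨x, t, h1, h2, h3, h4⟩ := h.rep.exists_points h.convex (genVec w) (genVec_nonneg w)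
    (fun g => mem_orth.2 (dotProduct_genVec w g))
    (fun c hc hcw => exists_combination w c hc (mem_orth.1 hcw))
  exact ⟨x, t, h1, h2, h3, h4⟩

theorem genVec_inl_ne_zero {c : {c // w c = 0}} {a : ι} :
    genVec w (.inl c) a ≠ 0 ↔ a = c := by
  simp [genVec, Pi.single_apply]

theorem genVec_inr_ne_zero {i : {i // 0 < w i}} {j : {j // w j < 0}} {a : ι} :
    genVec w (.inr (i, j)) a ≠ 0 ↔ a = i ∨ a = j := by
  have hij : (i : ι) ≠ j := fun h => by
    have h1 := i.2
    have h2 := j.2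
    rw [h] at h1
    linarith
  simp only [genVec, Pi.add_apply, Pi.single_apply]
  by_cases h1 : a = i
  · subst h1
    simp [hij, j.2.ne]
  · by_cases h2 : a = j
    · subst h2
      simp [h1, i.2.ne']
    · simp [h1, h2]

theorem gens_ext {g g' : Gens w} (h : ∀ a, genVec w g a ≠ 0 ↔ genVec w g' a ≠ 0) : g = g' := by
  rcases g with c | ⟨i, j⟩ <;> rcases g' with c' | ⟨i', j'⟩
  · simp only [genVec_inl_ne_zero] at h
    rw [Subtype.ext ((h c).1 rfl)]
  · simp only [genVec_inl_ne_zero, genVec_inr_ne_zero] at h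
    have h1 := (h i').2 (Or.inl rfl)
    have h2 := i'.2
    rw [h1, c.2] at h2
    exact absurd h2 (lt_irrefl _)
  · simp only [genVec_inl_ne_zero, genVec_inr_ne_zero] at h
    have h1 := (h i).1 (Or.inl rfl)
    have h2 := i.2
    rw [h1, c'.2] at h2
    exact absurd h2 (lt_irrefl _)
  · simp only [genVec_inr_ne_zero] at h
    have hi : i = i' := by
      rcases (h i).1 (Or.inl rfl) with h1 | h1
      · exact Subtype.ext h1
      · have h2 := i.2
        rw [h1] at h2
        exact absurd h2 (not_lt_of_gt j'.2)
    have hj : j = j' := by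
      rcases (h j).1 (Or.inr rfl) with h1 | h1
      · have h2 := j.2
        rw [h1] at h2
        exact absurd h2 (not_lt_of_gt i'.2)
      · exact Subtype.ext h1
    rw [hi, hj]

theorem genVec_ne_zero (g : Gens w) : ∃ a, genVec w g a ≠ 0 := by
  rcases g with c | ⟨i, j⟩
  · exact ⟨c, genVec_inl_ne_zero.2 rfl⟩
  · exact ⟨i, genVec_inr_ne_zero.2 (Or.inl rfl)⟩

theorem eq_smul_genVec {g : Gens w} {z : ι → ℝ} (hz : dotProduct w z = 0)
    (hsupp : ∀ a, genVec w g a = 0 → z a = 0) : ∃ μ : ℝ, z = μ • genVec w g := by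
  have hs : ∀ a, z a ≠ 0 → genVec w g a ≠ 0 := fun a h h' => h (hsupp a h')
  rcases g with c | ⟨i, j⟩
  · refine ⟨z c, ?_⟩
    ext a
    by_cases ha : a = c
    · subst ha; simp [genVec]
    · have : z a = 0 := by
        by_contra h; exact ha (genVec_inl_ne_zero.1 (hs a h))
      simp [genVec, this, ha]
  · have hij : (i : ι) ≠ j := fun h => by
      have h1 := i.2
      have h2 := j.2
      rw [h] at h1
      linarith
    have h0 : ∀ a : ι, a ≠ i → a ≠ j → z a = 0 := by
      intro a h1 h2
      by_contra h
      rcases genVec_inr_ne_zero.1 (hs a h) with h3 | h3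
      · exact h1 h3
      · exact h2 h3
    have hsum : w i * z i + w j * z j = 0 := by
      refine Eq.trans (Fintype.sum_eq_add (f := fun a => w a * z a) _ _ hij ?_).symm hz
      rintro a ⟨h1, h2⟩
      rw [h0 a h1 h2, mul_zero]
    have hi := i.2.ne'
    refine ⟨z j / w i, ?_⟩
    ext a
    simp only [genVec, Pi.smul_apply, Pi.add_apply, Pi.single_apply, smul_eq_mul]
    by_cases h1 : a = i
    · subst h1
      simp only [if_true, hij, if_false, add_zero]
      field_simp
      linarith
    · by_cases h2 : a = j
      · subst h2
        simp only [if_true, h1, if_false, zero_add]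
        field_simp
      · simp [h1, h2, h0 a h1 h2]

/-- A generator survives the projection if `r` has both signs outside its support. -/
def Survives (w r : ι → ℝ) (g : Gens w) : Prop :=
  (∃ a, genVec w g a = 0 ∧ 0 < r a) ∧ ∃ a, genVec w g a = 0 ∧ r a < 0

/-- A multiple of r that is nonnegative outside the support of g must vanish, as r has both signs
there. This makes the preimage of the ray through x g unique. -/
theorem Survives.eq_zero {g : Gens w} (hg : Survives w r g) {z : ι → ℝ} {τ : ℝ}
    (hz : ∀ a, genVec w g a = 0 → 0 ≤ z a) (h : ∀ a, genVec w g a = 0 → z a = τ * r a) :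
    τ = 0 := by
  obtain ⟨⟨a, ha, hra⟩, b, hb, hrb⟩ := hg
  have h1 := hz a ha
  have h2 := hz b hb
  rw [h a ha] at h1
  rw [h b hb] at h2
  have h3 : 0 ≤ τ := nonneg_of_mul_nonneg_left h1 hra
  have h4 : τ ≤ 0 := by
    by_contra! hcon
    exact absurd h2 (not_le.2 (mul_neg_of_pos_of_neg hcon hrb))
  exact le_antisymm h4 h3

variable {x : Gens w → E} {t : Gens w → ℝ}

theorem IsProjection.pos_of_survives (h : IsProjection P w r ρ) (hx : IsGenPoints P w ρ x t)
    {g : Gens w} (hg : Survives w r g) : 0 < t g := by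
  refine lt_of_le_of_ne (hx.nonneg g) fun h0 => ?_
  have h1 := hx.map g
  rw [← h0, zero_smul, h.ker _ (dotProduct_genVec w g)] at h1
  obtain ⟨τ, hτ⟩ := h1
  have h2 : τ = 0 := hg.eq_zero (z := genVec w g) (fun a _ => genVec_nonneg w g a)
    fun a _ => by rw [hτ]; rfl
  obtain ⟨a, ha⟩ := genVec_ne_zero g
  rw [hτ, h2] at ha
  simp at ha

/-- Lift a segment through x g to the slack cone. The lifts combine to a multiple of the generator
plus τ r, survival gives τ = 0, and nonnegativity then confines each lift to the support of g. -/
theorem IsProjection.vertex_of_survives (h : IsProjection P w r ρ) (hx : IsGenPoints P w ρ x t)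
    {g : Gens w} (hg : Survives w r g) : x g ∈ vertices P := by
  have ht := h.pos_of_survives hx hg
  refine mem_extremePoints_iff_left.2 ⟨hx.mem g, ?_⟩
  rintro x₁ hx₁ x₂ hx₂ ⟨a, b, ha, hb, hab, hxab⟩
  obtain ⟨z₁, hz₁, hz₁0, hρ₁⟩ := h.rep.lift x₁ hx₁
  obtain ⟨z₂, hz₂, hz₂0, hρ₂⟩ := h.rep.lift x₂ hx₂
  have hmem : a • z₁ + b • z₂ - (t g)⁻¹ • genVec w g ∈ orth w :=
    Submodule.sub_mem _ (Submodule.add_mem _ (Submodule.smul_mem _ _ hz₁)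
      (Submodule.smul_mem _ _ hz₂)) (Submodule.smul_mem _ _ (mem_orth.2 (dotProduct_genVec w g)))
  have hker : ρ (a • z₁ + b • z₂ - (t g)⁻¹ • genVec w g) = 0 := by
    rw [map_sub, map_add, map_smul, map_smul, map_smul, hρ₁, hρ₂, hx.map, ← hom_combo hab, hxab,
      smul_smul, inv_mul_cancel₀ ht.ne', one_smul, sub_self]
  obtain ⟨τ, hτ⟩ := (h.ker _ (mem_orth.1 hmem)).1 hker
  have hval : ∀ c, genVec w g c = 0 → a * z₁ c + b * z₂ c = τ * r c := by
    intro c hc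
    have := congrFun hτ c
    simpa [hc] using this
  have hτ0 : τ = 0 := hg.eq_zero (z := fun c => a * z₁ c + b * z₂ c)
    (fun c _ => add_nonneg (mul_nonneg ha.le (hz₁0 c)) (mul_nonneg hb.le (hz₂0 c))) hval
  obtain ⟨μ, hμ⟩ := eq_smul_genVec (g := g) (mem_orth.1 hz₁) fun c hc => by
    have h1 := hval c hc
    rw [hτ0, zero_mul] at h1
    have h2 := mul_nonneg ha.le (hz₁0 c)
    have h3 := mul_nonneg hb.le (hz₂0 c)
    have h4 : a * z₁ c = 0 := by linarith
    exact (mul_eq_zero.1 h4).resolve_left ha.ne'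
  rw [hμ, map_smul, hx.map, smul_smul] at hρ₁
  have h5 := congrArg Prod.snd hρ₁
  simp only [Prod.smul_snd, hom_snd, smul_eq_mul, mul_one] at h5
  rw [h5, one_smul] at hρ₁
  exact (hom_injective hρ₁).symm

theorem IsProjection.eq_of_survives (h : IsProjection P w r ρ) (hx : IsGenPoints P w ρ x t)
    {g g' : Gens w} (hg : Survives w r g) (heq : x g = x g') : g = g' := by
  have ht := h.pos_of_survives hx hg
  have hmem : t g • genVec w g' - t g' • genVec w g ∈ orth w :=
    Submodule.sub_mem _ (Submodule.smul_mem _ _ (mem_orth.2 (dotProduct_genVec w g')))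
      (Submodule.smul_mem _ _ (mem_orth.2 (dotProduct_genVec w g)))
  have hker : ρ (t g • genVec w g' - t g' • genVec w g) = 0 := by
    rw [map_sub, map_smul, map_smul, hx.map, hx.map, heq, smul_smul, smul_smul, mul_comm, sub_self]
  obtain ⟨τ, hτ⟩ := (h.ker _ (mem_orth.1 hmem)).1 hker
  have hτ0 : τ = 0 := hg.eq_zero (z := t g • genVec w g')
    (fun c _ => mul_nonneg ht.le (genVec_nonneg w g' c)) fun c hc => by
      have := congrFun hτ c
      simpa [hc] using this
  have h1 : ∀ c, t g * genVec w g' c = t g' * genVec w g c := by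
    intro c
    have := congrFun hτ c
    simp only [hτ0, Pi.sub_apply, Pi.smul_apply, smul_eq_mul] at this
    linarith
  have ht' : t g' ≠ 0 := by
    intro h0
    obtain ⟨c, hc⟩ := genVec_ne_zero g'
    have := h1 c
    rw [h0, zero_mul, mul_eq_zero] at this
    exact hc (this.resolve_left ht.ne')
  refine gens_ext fun c => ?_
  have h2 := h1 c
  constructor
  · intro hc h0
    rw [h0, mul_zero] at h2
    exact mul_ne_zero ht' hc h2.symm
  · intro hc h0
    rw [h0, mul_zero] at h2
    exact mul_ne_zero ht.ne' hc h2

/-- The support of a generator. -/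
noncomputable def genSupp (g : Gens w) : Finset ι := {a | genVec w g a ≠ 0}

theorem mem_genSupp {g : Gens w} {a : ι} : a ∈ genSupp g ↔ genVec w g a ≠ 0 := by
  simp [genSupp]

theorem genSupp_card_le (g : Gens w) : (genSupp g).card ≤ 2 := by
  rcases g with c | ⟨i, j⟩
  · have : genSupp (.inl c : Gens w) ⊆ {(c : ι)} := by
      intro a ha
      rw [mem_genSupp, genVec_inl_ne_zero] at ha
      simp [ha]
    exact (Finset.card_le_card this).trans (by simp)
  · have : genSupp (.inr (i, j) : Gens w) ⊆ {(i : ι), (j : ι)} := by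
      intro a ha
      rw [mem_genSupp, genVec_inr_ne_zero] at ha
      simp [ha]
    exact (Finset.card_le_card this).trans Finset.card_le_two

theorem not_survives {g : Gens w} (h : ¬ Survives w r g) :
    Finset.univ.filter (fun a => 0 < r a) ⊆ genSupp g ∨
      Finset.univ.filter (fun a => r a < 0) ⊆ genSupp g := by
  rw [Survives, not_and_or] at h
  push Not at h
  rcases h with h | h
  · left
    intro a ha
    rw [mem_genSupp]
    intro h0
    exact absurd (Finset.mem_filter.1 ha).2 (not_lt.2 (h a h0))
  · right
    intro a ha
    rw [mem_genSupp]
    intro h0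
    exact absurd (Finset.mem_filter.1 ha).2 (not_lt.2 (h a h0))

theorem card_gens (w : ι → ℝ) : Fintype.card (Gens w) = Fintype.card {c // w c = 0} +
    Fintype.card {i // 0 < w i} * Fintype.card {j // w j < 0} := by
  rw [Fintype.card_sum, Fintype.card_prod]

/-- Each sign class of r has at least two elements and the support of a generator at most two, so a
failing generator has a whole sign class as support. Both classes cannot have size two, because 2 +
2 + 1 > 2 · 2, and a generator is determined by its support. -/
theorem not_survives_unique
    (hr : Fintype.card {i // 0 < r i} + Fintype.card {i // r i < 0} + 1 ≤
      Fintype.card {i // 0 < r i} * Fintype.card {i // r i < 0})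
    {g g' : Gens w} (hg : ¬ Survives w r g) (hg' : ¬ Survives w r g') : g = g' := by
  rw [Fintype.card_subtype, Fintype.card_subtype] at hr
  set A := Finset.univ.filter (fun a => 0 < r a)
  set B := Finset.univ.filter (fun a => r a < 0)
  have hA : 2 ≤ A.card := by
    by_contra! hcon
    interval_cases A.card <;> omega
  have hB : 2 ≤ B.card := by
    by_contra! hcon
    interval_cases B.card <;> omega
  have hsub : ∀ {C : Finset ι} {g : Gens w}, 2 ≤ C.card → C ⊆ genSupp g →
      C = genSupp g ∧ C.card = 2 := by
    intro C g h2 hC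
    have h3 := genSupp_card_le g
    have h4 := Finset.card_le_card hC
    exact ⟨Finset.eq_of_subset_of_card_le hC (by omega), by omega⟩
  have hext : genSupp g = genSupp g' → g = g' := fun h => gens_ext fun a => by
    rw [← mem_genSupp, ← mem_genSupp, h]
  rcases not_survives hg with h | h <;> rcases not_survives hg' with h' | h'
  · exact hext ((hsub hA h).1.symm.trans (hsub hA h').1)
  · have h1 := (hsub hA h).2
    have h2 := (hsub hB h').2
    rw [h1, h2] at hr
    omega
  · have h1 := (hsub hB h).2
    have h2 := (hsub hA h').2
    rw [h1, h2] at hr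
    omega
  · exact hext ((hsub hB h).1.symm.trans (hsub hB h').1)

theorem IsProjection.sign_count (h : IsProjection P w r ρ)
    (hf : Fintype.card ι + 1 ≤ (facets P).ncard) :
    Fintype.card {i // 0 < r i} + Fintype.card {i // r i < 0} + 1 ≤
      Fintype.card {i // 0 < r i} * Fintype.card {i // r i < 0} := by
  have h1 := h.facets_le
  rw [card_gens] at h1
  have h2 := card_eq_pos_add_neg_add_zero r
  omega

theorem IsProjection.vertices_le (hx : IsGenPoints P w ρ x t) :
    (vertices P).ncard ≤ Fintype.card (Gens w) := vertices_ncard_le hx.hull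

theorem IsProjection.le_vertices (h : IsProjection P w r ρ) (hx : IsGenPoints P w ρ x t)
    (hr : Fintype.card {i // 0 < r i} + Fintype.card {i // r i < 0} + 1 ≤
      Fintype.card {i // 0 < r i} * Fintype.card {i // r i < 0}) :
    Fintype.card (Gens w) ≤ (vertices P).ncard + 1 ∧
      ((∀ g, Survives w r g) → Fintype.card (Gens w) ≤ (vertices P).ncard) := by
  have hfin : (vertices P).Finite := by
    have := hx.hull
    rw [this]
    exact (Set.finite_range x).subset extremePoints_convexHull_subset
  have key : {g | Survives w r g}.ncard ≤ (vertices P).ncard := by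
    refine Set.ncard_le_ncard_of_injOn x (fun g hg => h.vertex_of_survives hx hg) ?_ hfin
    intro g hg g' _ heq
    exact h.eq_of_survives hx hg heq
  have hcompl := Set.ncard_add_ncard_compl {g | Survives w r g}
  rw [Nat.card_eq_fintype_card] at hcompl
  constructor
  · have : ({g | Survives w r g}ᶜ : Set (Gens w)).ncard ≤ 1 :=
      (Set.ncard_le_one_iff (Set.toFinite _)).2 fun hg hg' => not_survives_unique hr hg hg'
    omega
  · intro hall
    have : ({g | Survives w r g}ᶜ : Set (Gens w)) = ∅ := by
      ext g
      simp [hall g]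
    rw [this, Set.ncard_empty] at hcompl
    omega

theorem product_cases {p q : ℕ} (h1 : p + q + 1 ≤ p * q) (h2 : p * q ≤ p + q + 2) :
    (p = 2 ∧ (q = 3 ∨ q = 4)) ∨ (q = 2 ∧ (p = 3 ∨ p = 4)) := by
  have hp : 2 ≤ p := by
    by_contra! hcon
    interval_cases p <;> omega
  have hq : 2 ≤ q := by
    by_contra! hcon
    interval_cases q <;> omega
  obtain ⟨a, rfl⟩ := Nat.exists_eq_add_of_le hp
  obtain ⟨b, rfl⟩ := Nat.exists_eq_add_of_le hq
  have h3 : a * b + a + b ≤ 2 := by nlinarith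
  have h4 : a ≤ 2 := by nlinarith
  have h5 : b ≤ 2 := by nlinarith
  interval_cases a <;> interval_cases b <;> omega

end Counting

/-! ### Combinatorial equivalence and recognition of prisms -/

section Prism

variable {E F : Type*} [NormedAddCommGroup E] [NormedSpace ℝ E] [FiniteDimensional ℝ E]
  [NormedAddCommGroup F] [NormedSpace ℝ F] [FiniteDimensional ℝ F]

theorem sep_range {G X : Type*} (x : G → X) (p : X → Prop) :
    {y ∈ Set.range x | p y} = x '' {g | p (x g)} := by
  ext y
  constructor
  · rintro ⟨⟨g, rfl⟩, h⟩
    exact ⟨g, h, rfl⟩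
  · rintro ⟨g, h, rfl⟩
    exact ⟨⟨g, rfl⟩, h⟩

theorem face_eq_convexHull {G : Type*} (x : G → E) {A : Set E}
    (hA : A ∈ faces (convexHull ℝ (Set.range x))) : A = convexHull ℝ (x '' {g | x g ∈ A}) := by
  obtain ⟨f, hf, rfl⟩ := mem_faces_iff.1 hA
  rw [zeros_convexHull fun y hy => hf y (subset_convexHull _ _ hy), sep_range]
  congr 2
  ext g
  constructor
  · exact fun h => subset_convexHull _ _ ⟨g, h, rfl⟩
  · intro h
    refine eq_on_convexHull (g := 0) ?_ h
    rintro _ ⟨g, hg, rfl⟩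
    simpa using hg

/-- The face lattice embeds into the lattice of vertex sets. -/
def faceEmbedding {G : Type*} (x : G → E) : faces (convexHull ℝ (Set.range x)) ↪o Set G :=
  OrderEmbedding.ofMapLEIff (fun A => {g | x g ∈ (A : Set E)}) (by
    intro A B
    constructor
    · intro h
      change (A : Set E) ⊆ B
      rw [face_eq_convexHull x A.2, face_eq_convexHull x B.2]
      exact convexHull_mono (Set.image_mono h)
    · exact fun h g hg => h hg)

theorem range_faceEmbedding {G : Type*} (x : G → E) : Set.range (faceEmbedding x) =
    {Z | ∃ f : E × ℝ →ₗ[ℝ] ℝ, (∀ g, 0 ≤ f (hom (x g))) ∧ Z = {g | f (hom (x g)) = 0}} := by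
  have hmem : ∀ g, x g ∈ convexHull ℝ (Set.range x) := fun g => subset_convexHull _ _ ⟨g, rfl⟩
  ext Z
  constructor
  · rintro ⟨⟨A, hA⟩, rfl⟩
    obtain ⟨f, hf, rfl⟩ := mem_faces_iff.1 hA
    refine ⟨f, fun g => hf _ (hmem g), ?_⟩
    ext g
    exact ⟨fun h => h.2, fun h => ⟨hmem g, h⟩⟩
  · rintro ⟨f, hf, rfl⟩
    have hf' : NonnegOn f (convexHull ℝ (Set.range x)) := NonnegOn.convexHull (by
      rintro _ ⟨g, rfl⟩
      exact hf g)
    refine ⟨⟨_, mem_faces_iff.2 ⟨f, hf', rfl⟩⟩, ?_⟩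
    ext g
    exact ⟨fun h => h.2, fun h => ⟨hmem g, h⟩⟩

/-- Polytopes whose affine functions have, up to positive weights, the same values on the
vertices are combinatorially equivalent. -/
theorem combEquiv_of_weights {G : Type*} (x : G → E) (y : G → F) (lam : G → ℝ)
    (hlam : ∀ g, 0 < lam g)
    (h₁ : ∀ f : E × ℝ →ₗ[ℝ] ℝ, ∃ f' : F × ℝ →ₗ[ℝ] ℝ, ∀ g, f' (hom (y g)) = lam g * f (hom (x g)))
    (h₂ : ∀ f' : F × ℝ →ₗ[ℝ] ℝ, ∃ f : E × ℝ →ₗ[ℝ] ℝ,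
      ∀ g, f' (hom (y g)) = lam g * f (hom (x g))) :
    CombEquiv (convexHull ℝ (Set.range x)) (convexHull ℝ (Set.range y)) := by
  have hrange : Set.range (faceEmbedding x) = Set.range (faceEmbedding y) := by
    rw [range_faceEmbedding, range_faceEmbedding]
    have key : ∀ (f : E × ℝ →ₗ[ℝ] ℝ) (f' : F × ℝ →ₗ[ℝ] ℝ),
        (∀ g, f' (hom (y g)) = lam g * f (hom (x g))) →
        ((∀ g, 0 ≤ f (hom (x g))) ↔ ∀ g, 0 ≤ f' (hom (y g))) ∧
        {g | f (hom (x g)) = 0} = {g | f' (hom (y g)) = 0} := by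
      intro f f' h
      simp [h, hlam, (hlam _).ne']
    ext Z
    constructor
    · rintro ⟨f, hf, rfl⟩
      obtain ⟨f', hf'⟩ := h₁ f
      exact ⟨f', (key f f' hf').1.1 hf, (key f f' hf').2⟩
    · rintro ⟨f', hf', rfl⟩
      obtain ⟨f, hf⟩ := h₂ f'
      exact ⟨f, (key f f' hf).1.2 hf', (key f f' hf).2.symm⟩
  exact ⟨(faceEmbedding x).orderIso.trans
    ((OrderIso.setCongr _ _ hrange).trans (faceEmbedding y).orderIso.symm)⟩

variable {ι : Type*} [Fintype ι] [DecidableEq ι] {P : Set E} {w r : ι → ℝ}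
  {ρ : (ι → ℝ) →ₗ[ℝ] E × ℝ} {x : Gens w → E} {t : Gens w → ℝ}

theorem hom_prodVertex {κ μ : Type*} [Fintype κ] [Fintype μ] [DecidableEq κ] [DecidableEq μ]
    (f : ((κ → ℝ) × (μ → ℝ)) × ℝ →ₗ[ℝ] ℝ) :
    ∃ (a : κ → ℝ) (b : μ → ℝ), ∀ ij : κ × μ, f (hom (prodVertex ij)) = a ij.1 + b ij.2 := by
  refine ⟨fun i => f ((Pi.single i 1, 0), 1), fun j => f ((0, Pi.single j 1), 0), fun ij => ?_⟩
  rw [← map_add]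
  simp [hom, prodVertex]

/-- The image of a subproduct of simplices that the projection direction leaves is a prism. -/
theorem IsProjection.isTriangularPrism (h : IsProjection P w r ρ) (hx : IsGenPoints P w ρ x t)
    (e : Fin 2 → {i // 0 < w i}) (f : Fin 3 → {j // w j < 0}) (he : Function.Injective e)
    (hf : Function.Injective f) (ht : ∀ ij : Fin 2 × Fin 3, 0 < t (.inr (e ij.1, f ij.2)))
    {m : ι} (hm : r m ≠ 0) (hme : ∀ i, m ≠ e i) (hmf : ∀ j, m ≠ f j) :
    IsTriangularPrism
      (convexHull ℝ (Set.range fun ij : Fin 2 × Fin 3 => x (.inr (e ij.1, f ij.2)))) := by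
  refine ⟨⟨_, Set.finite_range _, rfl⟩, ?_⟩
  rw [stdSimplex_prod_eq]
  have hw : ∀ ij : Fin 2 × Fin 3, 0 < w (e ij.1) * -w (f ij.2) := fun ij =>
    mul_pos (e ij.1).2 (neg_pos.2 (f ij.2).2)
  have hval : ∀ (g : E × ℝ →ₗ[ℝ] ℝ) (ij : Fin 2 × Fin 3),
      t (.inr (e ij.1, f ij.2)) * g (hom (x (.inr (e ij.1, f ij.2)))) =
      g (ρ (genVec w (.inr (e ij.1, f ij.2)))) := by
    intro g ij
    rw [hx.map, map_smul, smul_eq_mul]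
  -- The weights come from −w j e i + w i e j = (w i · −w j)(e i / w i + e j / (−w j)): up to
  -- scaling, the generators are the vertices of a product.
  refine combEquiv_of_weights _ _
    (fun ij => t (.inr (e ij.1, f ij.2)) / (w (e ij.1) * -w (f ij.2)))
    (fun ij => div_pos (ht ij) (hw ij)) ?_ ?_
  · intro g
    let a : Fin 2 → ℝ := fun i => g (ρ (Pi.single (e i : ι) 1)) / w (e i)
    let b : Fin 3 → ℝ := fun j => g (ρ (Pi.single (f j : ι) 1)) / -w (f j)
    refine ⟨((dotLin a).comp (LinearMap.fst ℝ _ _) + (dotLin b).comp (LinearMap.snd ℝ _ _)).comp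
      (LinearMap.fst ℝ _ ℝ), fun ij => ?_⟩
    have h1 := hval g ij
    have h2 : ∀ (k : ι) (c : ℝ), Pi.single k c = c • (Pi.single k 1 : ι → ℝ) := by
      intro k c; rw [← Pi.single_smul]; simp
    simp only [genVec, map_add] at h1
    rw [h2 _ (-w _), h2 _ (w _), map_smul, map_smul, map_smul, map_smul, smul_eq_mul,
      smul_eq_mul] at h1
    rw [div_mul_eq_mul_div, h1]
    have h3 := (e ij.1).2.ne'
    have h4 := (f ij.2).2.ne
    simp only [LinearMap.comp_apply, LinearMap.fst_apply, hom_fst, LinearMap.add_apply,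
      LinearMap.snd_apply, dotLin_apply, prodVertex, dotProduct_single, mul_one, a, b]
    field_simp
    ring
  · intro g
    obtain ⟨a, b, hab⟩ := hom_prodVertex g
    -- The relevant generators vanish at m and r does not, so ρ is injective on J and every
    -- functional on J descends.
    let J : Submodule ℝ (ι → ℝ) := orth w ⊓ LinearMap.ker (LinearMap.proj m)
    let φ : (ι → ℝ) →ₗ[ℝ] ℝ := ∑ i, (a i * w (e i)) • LinearMap.proj (e i : ι) +
      ∑ j, (b j * -w (f j)) • LinearMap.proj (f j : ι)
    obtain ⟨ψ, hψ⟩ := exists_factor J ρ φ (by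
      rintro z ⟨hz, hzm⟩ h0
      obtain ⟨τ, rfl⟩ := (h.ker z (mem_orth.1 hz)).1 h0
      have h1 : τ * r m = 0 := hzm
      rw [(mul_eq_zero.1 h1).resolve_right hm]
      simp)
    refine ⟨ψ, fun ij => ?_⟩
    rw [div_mul_eq_mul_div, hval, hψ, hab, eq_div_iff (hw ij).ne']
    · have h1 : ∀ i j, (e i : ι) ≠ f j := fun i j heq => by
        have h2 := (e i).2
        rw [heq] at h2
        exact absurd h2 (not_lt_of_gt (f j).2)
      have h2 : ∀ i i', ((e i : ι) = e i') ↔ i = i' := fun i i' => by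
        rw [← Subtype.ext_iff, he.eq_iff]
      have h3 : ∀ i i', ((f i : ι) = f i') ↔ i = i' := fun i i' => by
        rw [← Subtype.ext_iff, hf.eq_iff]
      simp only [φ, genVec, LinearMap.add_apply, LinearMap.sum_apply, LinearMap.smul_apply,
        LinearMap.proj_apply, Pi.add_apply, Pi.single_apply, h1, (h1 _ _).symm, h2, h3, if_false,
        add_zero, zero_add, smul_eq_mul, mul_ite, mul_zero, Finset.sum_ite_eq', Finset.mem_univ,
        if_true]
      ring
    · have h0 : genVec w (.inr (e ij.1, f ij.2)) m = 0 := by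
        by_contra hne
        rcases genVec_inr_ne_zero.1 hne with h1 | h1
        · exact hme _ h1
        · exact hmf _ h1
      exact ⟨mem_orth.2 (dotProduct_genVec w _), h0⟩

end Prism

/-! ### Iterated pyramids, concurrency and sign patterns -/

section Hexagon

variable {E : Type*} [NormedAddCommGroup E] [NormedSpace ℝ E] [FiniteDimensional ℝ E]

theorem hom_mem_of_mem_affineSpan {R : Set E} {a : E} (h : a ∈ affineSpan ℝ R) :
    hom a ∈ homSpan R := by
  refine affineSpan_induction (p := fun a => hom a ∈ homSpan R) h
    (fun y hy => hom_mem_homSpan hy) fun c u v z hu hv hz => ?_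
  have : hom (c • (u -ᵥ v) +ᵥ z) = c • (hom u - hom v) + hom z := by
    ext1 <;> simp [hom]
  rw [this]
  exact Submodule.add_mem _ (Submodule.smul_mem _ _ (Submodule.sub_mem _ hu hv)) hz

theorem finrank_homSpan_insert {R : Set E} {a : E} (h : hom a ∉ homSpan R) :
    Module.finrank ℝ (homSpan (insert a R)) = Module.finrank ℝ (homSpan R) + 1 := by
  have h1 : homSpan (insert a R) = homSpan R ⊔ Submodule.span ℝ {hom a} := by
    rw [homSpan, Set.image_insert_eq, Submodule.span_insert, sup_comm]
    rfl
  have h0 : hom a ≠ 0 := fun h0 => h (h0 ▸ Submodule.zero_mem _)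
  have h2 := Submodule.finrank_sup_add_finrank_inf_eq (homSpan R) (Submodule.span ℝ {hom a})
  have h3 : homSpan R ⊓ Submodule.span ℝ {hom a} = ⊥ :=
    disjoint_iff.1 ((Submodule.disjoint_span_singleton' h0).2 h)
  rw [h3, finrank_bot, finrank_span_singleton h0] at h2
  rw [h1]
  omega

/-- Adding linearly independent apexes produces an iterated pyramid. -/
theorem isPyramid_of_functionals {C : Type*} [DecidableEq C] (B : Set E) (a : C → E)
    (ψ : C → E × ℝ →ₗ[ℝ] ℝ) (hB : ∀ c, ∀ b ∈ B, ψ c (hom b) = 0)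
    (ha : ∀ c c', c ≠ c' → ψ c (hom (a c')) = 0) (haa : ∀ c, ψ c (hom (a c)) ≠ 0)
    (T : Finset C) :
    IsPyramid T.card (convexHull ℝ B) (convexHull ℝ (B ∪ a '' T)) ∧
      Module.finrank ℝ (homSpan (B ∪ a '' T)) = Module.finrank ℝ (homSpan B) + T.card := by
  induction T using Finset.induction_on with
  | empty =>
    have h0 : B ∪ a '' ((∅ : Finset C) : Set C) = B := by simp
    rw [h0]
    exact ⟨rfl, rfl⟩
  | @insert c T hc ih =>
    have hnot : hom (a c) ∉ homSpan (B ∪ a '' T) := by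
      intro hmem
      apply haa c
      refine eq_on_homSpan (g := 0) ?_ hmem
      rintro b (hb | ⟨c', hc', rfl⟩)
      · simp [hB c b hb]
      · have : c ≠ c' := by
          rintro rfl
          exact hc hc'
        simp [ha c c' this]
    rw [Finset.coe_insert, Set.image_insert_eq, Set.union_insert, Finset.card_insert_of_notMem hc,
      finrank_homSpan_insert hnot, ih.2]
    refine ⟨⟨_, a c, ih.1, fun hmem => hnot ?_, ?_⟩, by ring⟩
    · rw [affineSpan_convexHull] at hmem
      exact hom_mem_of_mem_affineSpan hmem
    · rw [Set.insert_eq, Set.insert_eq, convexHull_convexHull_union_right]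

theorem eq_of_mem_vertices {P : Set E} {x y x' : E} (hx : x ∈ vertices P) (hy : y ∈ P)
    (hx' : x' ∈ P) {T s ε : ℝ} (hs : 0 ≤ s) (hε : 0 < ε)
    (h : T • hom x = s • hom y + ε • hom x') : x' = x := by
  have hT : T = s + ε := by simpa using congrArg Prod.snd h
  have hT0 : 0 < T := by linarith
  rcases hs.eq_or_lt with rfl | hs
  · rw [zero_smul, zero_add, hT, zero_add] at h
    exact (hom_injective (smul_right_injective _ hε.ne' h)).symm
  · refine ((mem_extremePoints.1 hx).2 y hy x' hx' ⟨s / T, ε / T, by positivity, by positivity,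
      by rw [← add_div, ← hT, div_self hT0.ne'], ?_⟩).2
    have h1 : T • x = s • y + ε • x' := by simpa using congrArg Prod.fst h
    rw [← inv_smul_smul₀ hT0.ne' x, h1, smul_add, smul_smul, smul_smul, div_eq_inv_mul,
      div_eq_inv_mul]

/-- X is the projective common point: at height 0 it is a common direction, otherwise it rescales to
a common affine point. -/
theorem concurrent_of_common_vector {a b : Fin 3 → E} {s t : Fin 3 → ℝ} {X : E × ℝ}
    (hs : ∀ j, 0 < s j) (hX : ∀ j, X = s j • hom (a j) - t j • hom (b j)) :
    ConcurrentLines (affineSpan ℝ {a 0, b 0}) (affineSpan ℝ {a 1, b 1})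
      (affineSpan ℝ {a 2, b 2}) := by
  have h2 : ∀ j, X.2 = s j - t j := fun j => by simpa using congrArg Prod.snd (hX j)
  have h1 : ∀ j, X.1 = s j • a j - t j • b j := fun j => by simpa using congrArg Prod.fst (hX j)
  by_cases h0 : X.2 = 0
  · right
    have hst : ∀ j, X.1 = s j • (a j - b j) := fun j => by
      rw [h1 j, smul_sub, show t j = s j by linarith [h2 j]]
    have key : ∀ j k, (affineSpan ℝ {a j, b j}).Parallel (affineSpan ℝ {a k, b k}) := by
      intro j k
      rw [AffineSubspace.affineSpan_pair_parallel_iff_exists_unit_smul']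
      refine ⟨Units.mk0 (s j / s k) (div_pos (hs j) (hs k)).ne', ?_⟩
      have h3 := (hst j).symm.trans (hst k)
      rw [Units.smul_mk0, vsub_eq_sub, vsub_eq_sub, div_eq_inv_mul, mul_smul, ← neg_sub (a j),
        ← neg_sub (a k), smul_neg, h3, smul_neg, inv_smul_smul₀ (hs k).ne']
    exact ⟨key 0 1, key 1 2⟩
  · left
    have key : ∀ j, X.2⁻¹ • X.1 ∈ affineSpan ℝ {a j, b j} := by
      intro j
      refine mem_affineSpan_pair_iff_exists_lineMap_eq.2 ⟨-t j / X.2, ?_⟩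
      have h3 : s j = X.2 + t j := by linarith [h2 j]
      have h4 : 1 - -t j / X.2 = X.2⁻¹ * s j := by
        rw [h3]
        field_simp
        ring
      rw [AffineMap.lineMap_apply_module, h1 j, h4]
      module
    exact ⟨_, key 0, key 1, key 2⟩

theorem hexagon_signs_of_neg {α : Fin 2 → ℝ} {β : Fin 3 → ℝ} {u : Fin 2 → ℝ} {v : Fin 3 → ℝ}
    (hu : ∀ i, 0 < u i) (hv : ∀ j, 0 < v j) (hsum : ∑ i, u i * α i = ∑ j, v j * β j)
    (hpos : ∀ i j, (∃ i', i' ≠ i ∧ 0 < α i') ∨ ∃ j', j' ≠ j ∧ 0 < β j') (hα : ∀ i, α i < 0) :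
    ∃ j, β j < 0 ∧ ∀ j', j' ≠ j → 0 < β j' := by
  have hneg : ∃ j, β j < 0 := by
    by_contra! hcon
    have h1 : ∑ i, u i * α i < 0 :=
      Finset.sum_neg (fun i _ => mul_neg_of_pos_of_neg (hu i) (hα i)) Finset.univ_nonempty
    have h2 : 0 ≤ ∑ j, v j * β j := Finset.sum_nonneg fun j _ => mul_nonneg (hv j).le (hcon j)
    linarith
  obtain ⟨j, hj⟩ := hneg
  refine ⟨j, hj, fun k hk => ?_⟩
  -- Omitting the third index l leaves only j and k, and β j is negative, so the required positive
  -- entry is β k.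
  obtain ⟨l, hlj, hlk⟩ : ∃ l : Fin 3, l ≠ j ∧ l ≠ k := by
    clear hj
    revert j k
    decide
  rcases hpos 0 l with ⟨i, -, hi⟩ | ⟨m, hml, hm⟩
  · exact absurd hi (not_lt_of_gt (hα i))
  · have : m = k := by
      have hmj : m ≠ j := by
        rintro rfl
        exact absurd hm (not_lt_of_gt hj)
      clear hm hj
      revert j k l m
      decide
    exact this ▸ hm

/-- If α has no strict common sign, one can omit an index of α so that the other is nonnegative, or
so that it is nonpositive. Then β must have a negative entry, respectively a positive one, after
omitting any of its indices: two of each sign among three entries. So α has a common sign, and the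
balance of the sums forces that sign on some β as well. -/
theorem hexagon_signs {α : Fin 2 → ℝ} {β : Fin 3 → ℝ} {u : Fin 2 → ℝ} {v : Fin 3 → ℝ}
    (hu : ∀ i, 0 < u i) (hv : ∀ j, 0 < v j) (hsum : ∑ i, u i * α i = ∑ j, v j * β j)
    (hpos : ∀ i j, (∃ i', i' ≠ i ∧ 0 < α i') ∨ ∃ j', j' ≠ j ∧ 0 < β j')
    (hneg : ∀ i j, (∃ i', i' ≠ i ∧ α i' < 0) ∨ ∃ j', j' ≠ j ∧ β j' < 0) :
    ((∀ i, α i < 0) ∧ ∃ j, β j < 0 ∧ ∀ j', j' ≠ j → 0 < β j') ∨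
      ((∀ i, 0 < α i) ∧ ∃ j, 0 < β j ∧ ∀ j', j' ≠ j → β j' < 0) := by
  by_cases h1 : ∀ i, α i < 0
  · exact Or.inl ⟨h1, hexagon_signs_of_neg hu hv hsum hpos h1⟩
  by_cases h2 : ∀ i, 0 < α i
  · right
    refine ⟨h2, ?_⟩
    have := hexagon_signs_of_neg (α := -α) (β := -β) hu hv
      (by simp only [Pi.neg_apply, mul_neg, Finset.sum_neg_distrib, hsum])
      (by simpa using hneg) (by simpa using h2)
    simpa using this
  exfalso
  push Not at h1 h2
  obtain ⟨i, hi⟩ := h1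
  obtain ⟨i', hi'⟩ := h2
  have hodd : ∃ k : Fin 2, (∀ m, m ≠ k → 0 ≤ α m) := by
    refine ⟨i + 1, fun m hm => ?_⟩
    have : m = i := by
      clear hi
      revert m i
      decide
    exact this ▸ hi
  have heven : ∃ k : Fin 2, (∀ m, m ≠ k → α m ≤ 0) := by
    refine ⟨i' + 1, fun m hm => ?_⟩
    have : m = i' := by
      clear hi'
      revert m i'
      decide
    exact this ▸ hi'
  obtain ⟨k, hk⟩ := hodd
  obtain ⟨k', hk'⟩ := heven
  have hn : ∀ j, ∃ j', j' ≠ j ∧ β j' < 0 := fun j => by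
    rcases hneg k j with ⟨m, hm, hm0⟩ | h
    · exact absurd hm0 (not_lt.2 (hk m hm))
    · exact h
  have hp : ∀ j, ∃ j', j' ≠ j ∧ 0 < β j' := fun j => by
    rcases hpos k' j with ⟨m, hm, hm0⟩ | h
    · exact absurd hm0 (not_lt.2 (hk' m hm))
    · exact h
  obtain ⟨a, -, ha⟩ := hn 0
  obtain ⟨b, hb, hb'⟩ := hn a
  obtain ⟨c, -, hc⟩ := hp 0
  obtain ⟨d, hd, hd'⟩ := hp c
  have hac : a ≠ c := fun h => by rw [h] at ha; linarith
  have had : a ≠ d := fun h => by rw [h] at ha; linarith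
  have hbc : b ≠ c := fun h => by rw [h] at hb'; linarith
  have hbd : b ≠ d := fun h => by rw [h] at hb'; linarith
  clear ha hb' hc hd' hn hp
  revert a b c d
  decide

end Hexagon

/-! ### Which generators give vertices -/

section Classification

variable {E : Type*} [NormedAddCommGroup E] [NormedSpace ℝ E] [FiniteDimensional ℝ E]
  {ι : Type*} [Fintype ι] [DecidableEq ι] {P : Set E} {w r : ι → ℝ}
  {ρ : (ι → ℝ) →ₗ[ℝ] E × ℝ} {x : Gens w → E} {t : Gens w → ℝ}

/-- The sign condition on the projection direction forced by the number of facets. -/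
def ManySigns (r : ι → ℝ) : Prop :=
  Fintype.card {i // 0 < r i} + Fintype.card {i // r i < 0} + 1 ≤
    Fintype.card {i // 0 < r i} * Fintype.card {i // r i < 0}

theorem ManySigns.two_le (h : ManySigns r) :
    2 ≤ Fintype.card {i // 0 < r i} ∧ 2 ≤ Fintype.card {i // r i < 0} := by
  unfold ManySigns at h
  generalize Fintype.card {i // 0 < r i} = a at *
  generalize Fintype.card {i // r i < 0} = b at *
  constructor
  · by_contra! hcon
    interval_cases a <;> omega
  · by_contra! hcon
    interval_cases b <;> omega

theorem ManySigns.neg (h : ManySigns r) : ManySigns (-r) := by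
  have h1 : Fintype.card {i // 0 < (-r) i} = Fintype.card {i // r i < 0} :=
    Fintype.card_congr (Equiv.subtypeEquivRight fun i => by simp)
  have h2 : Fintype.card {i // (-r) i < 0} = Fintype.card {i // 0 < r i} :=
    Fintype.card_congr (Equiv.subtypeEquivRight fun i => by simp)
  unfold ManySigns at *
  rw [h1, h2, mul_comm]
  omega

theorem ManySigns.exists_pos (h : ManySigns r) : ∃ a, 0 < r a := by
  have : 0 < Fintype.card {i // 0 < r i} := by have := h.two_le; omega
  obtain ⟨a⟩ := Fintype.card_pos_iff.1 this
  exact ⟨a, a.2⟩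

theorem ManySigns.exists_neg (h : ManySigns r) : ∃ a, r a < 0 := by
  have : 0 < Fintype.card {i // r i < 0} := by have := h.two_le; omega
  obtain ⟨a⟩ := Fintype.card_pos_iff.1 this
  exact ⟨a, a.2⟩

theorem IsProjection.scale_pos (h : IsProjection P w r ρ) (hx : IsGenPoints P w ρ x t)
    (hr : ManySigns r) (g : Gens w) : 0 < t g := by
  refine lt_of_le_of_ne (hx.nonneg g) fun h0 => ?_
  have h1 := hx.map g
  rw [← h0, zero_smul, h.ker _ (dotProduct_genVec w g)] at h1
  obtain ⟨τ, hτ⟩ := h1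
  obtain ⟨a, ha⟩ := hr.exists_pos
  obtain ⟨b, hb⟩ := hr.exists_neg
  have h2 : 0 ≤ τ * r a := by
    have := genVec_nonneg w g a
    rwa [hτ] at this
  have h3 : 0 ≤ τ * r b := by
    have := genVec_nonneg w g b
    rwa [hτ] at this
  have h4 : 0 ≤ τ := nonneg_of_mul_nonneg_left h2 ha
  have h5 : τ ≤ 0 := by
    by_contra! hcon
    exact absurd h3 (not_le.2 (mul_neg_of_pos_of_neg hcon hb))
  obtain ⟨c, hc⟩ := genVec_ne_zero g
  rw [hτ, le_antisymm h5 h4] at hc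
  simp at hc

/-- The support of a generator that does not survive is one of the two sign classes. -/
theorem ManySigns.supp_eq (hr : ManySigns r) {g : Gens w} (hg : ¬ Survives w r g) :
    (∀ a, genVec w g a ≠ 0 ↔ 0 < r a) ∨ ∀ a, genVec w g a ≠ 0 ↔ r a < 0 := by
  have h2 := hr.two_le
  rw [Fintype.card_subtype, Fintype.card_subtype] at h2
  have h3 := genSupp_card_le g
  rcases not_survives hg with h | h
  · left
    have := Finset.eq_of_subset_of_card_le h (by omega)
    intro a
    rw [← mem_genSupp, ← this]
    simp
  · right
    have := Finset.eq_of_subset_of_card_le h (by omega)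
    intro a
    rw [← mem_genSupp, ← this]
    simp

theorem ManySigns.exists_pair (hr : ManySigns r) {g : Gens w} (hg : ¬ Survives w r g) :
    ∃ i j, g = .inr (i, j) ∧ r j ≠ 0 := by
  rcases g with c | ⟨i, j⟩
  · exfalso
    have h2 := hr.two_le
    rcases hr.supp_eq hg with h | h
    · have h3 : Fintype.card {i // 0 < r i} ≤ 1 := by
        refine Fintype.card_le_one_iff.2 fun a b => Subtype.ext ?_
        rw [genVec_inl_ne_zero.1 ((h a).2 a.2), genVec_inl_ne_zero.1 ((h b).2 b.2)]
      omega
    · have h3 : Fintype.card {i // r i < 0} ≤ 1 := by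
        refine Fintype.card_le_one_iff.2 fun a b => Subtype.ext ?_
        rw [genVec_inl_ne_zero.1 ((h a).2 a.2), genVec_inl_ne_zero.1 ((h b).2 b.2)]
      omega
  · refine ⟨i, j, rfl, ?_⟩
    have hj : genVec w (.inr (i, j)) j ≠ 0 := genVec_inr_ne_zero.2 (Or.inr rfl)
    rcases hr.supp_eq hg with h | h
    · exact ((h j).1 hj).ne'
    · exact ((h j).1 hj).ne

theorem IsProjection.prism_of_injective (h : IsProjection P w r ρ) (hx : IsGenPoints P w ρ x t)
    (hr : ManySigns r) (e : Fin 2 → {i // 0 < w i}) (f : Fin 3 → {j // w j < 0})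
    (he : Function.Injective e) (hf : Function.Injective f)
    {m : ι} (hm : r m ≠ 0) (hme : ∀ i, m ≠ e i) (hmf : ∀ j, m ≠ f j)
    (hvert : ∀ i j, x (.inr (e i, f j)) ∈ vertices P)
    (hinj : ∀ i j i' j', x (.inr (e i, f j)) = x (.inr (e i', f j')) →
      (.inr (e i, f j) : Gens w) = .inr (e i', f j')) :
    ∃ S : Set E, S ⊆ vertices P ∧ S.ncard = 6 ∧ IsTriangularPrism (convexHull ℝ S) := by
  refine ⟨_, ?_, ?_, h.isTriangularPrism hx e f he hf (fun ij => h.scale_pos hx hr _) hm hme hmf⟩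
  · rintro _ ⟨ij, rfl⟩
    exact hvert _ _
  · rw [Set.ncard_range_of_injective]
    · simp
    · rintro ⟨i, j⟩ ⟨i', j'⟩ heq
      have := hinj i j i' j' heq
      simp only [Sum.inr.injEq, Prod.mk.injEq, he.eq_iff, hf.eq_iff] at this
      rw [this.1, this.2]

/-- There is one generator more than there are vertices, so some pair (i₀, j₀) does not survive. Its
support is a sign class of r, so r is nonzero at j₀, and deleting j₀ leaves a 2 × 3 array of
surviving generators that r projects injectively. -/
theorem IsProjection.prism_of_four (h : IsProjection P w r ρ) (hr : ManySigns r)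
    (hp : Fintype.card {i // 0 < w i} = 2) (hq : Fintype.card {j // w j < 0} = 4)
    (hv : (vertices P).ncard = Fintype.card ι + 1) :
    ∃ S : Set E, S ⊆ vertices P ∧ S.ncard = 6 ∧ IsTriangularPrism (convexHull ℝ S) := by
  obtain ⟨x, t, hx⟩ := h.exists_genPoints
  have h1 := (h.le_vertices hx hr).2
  have h2 := card_gens w
  have h3 := card_eq_pos_add_neg_add_zero w
  rw [hp, hq] at h2 h3
  have hex : ∃ g, ¬ Survives w r g := by
    by_contra! hcon
    have := h1 hcon
    omega
  obtain ⟨g₀, hg₀⟩ := hex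
  obtain ⟨i₀, j₀, rfl, hrj⟩ := hr.exists_pair hg₀
  have hcard : Fintype.card {j : {j // w j < 0} // j ≠ j₀} = 3 := by
    rw [Fintype.card_subtype_compl, hq, Fintype.card_unique]
  let e := (Fintype.equivFinOfCardEq hp).symm
  let f' := (Fintype.equivFinOfCardEq hcard).symm
  have hsurv : ∀ i j, Survives w r (.inr (e i, (f' j : {j // w j < 0}))) := by
    intro i j
    by_contra hcon
    have := not_survives_unique hr hg₀ hcon
    simp only [Sum.inr.injEq, Prod.mk.injEq] at this
    exact (f' j).2 this.2.symm
  refine h.prism_of_injective hx hr e (fun j => f' j) e.injective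
    (Subtype.val_injective.comp f'.injective) hrj ?_ ?_
    (fun i j => h.vertex_of_survives hx (hsurv i j))
    (fun i j i' j' heq => h.eq_of_survives hx (hsurv i j) heq)
  · intro i heq
    have := (e i).2
    rw [← heq] at this
    exact absurd this (not_lt_of_gt j₀.2)
  · intro j heq
    exact (f' j).2 (Subtype.ext heq.symm)

/-- With as many vertices as generators, the generators give the vertices bijectively. -/
theorem IsGenPoints.bijective (hx : IsGenPoints P w ρ x t)
    (hv : Fintype.card (Gens w) ≤ (vertices P).ncard) :
    Function.Injective x ∧ Set.range x = vertices P := by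
  have hsub : vertices P ⊆ Set.range x := by
    conv_lhs => rw [hx.hull]
    exact extremePoints_convexHull_subset
  have h1 := Set.ncard_le_ncard hsub (Set.finite_range x)
  have h2 := ncard_range_le x
  refine ⟨?_, (Set.eq_of_subset_of_ncard_le hsub (by omega) (Set.finite_range x)).symm⟩
  have h3 : (Set.univ : Set (Gens w)).ncard = Fintype.card (Gens w) := by
    rw [Set.ncard_univ, Nat.card_eq_fintype_card]
  have h4 : (x '' Set.univ).ncard = (Set.univ : Set (Gens w)).ncard := by
    rw [Set.image_univ, h3]
    omega
  exact Set.injOn_univ.1 ((Set.ncard_image_iff Set.finite_univ).1 h4)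

/-- If all generators give distinct vertices and `r` is positive exactly on the support of a
generator, then `r` is not negative on a second, disjoint generator. -/
theorem IsProjection.false_of_supp_pos (h : IsProjection P w r ρ) (hx : IsGenPoints P w ρ x t)
    (hr : ManySigns r) (hinj : Function.Injective x) (hrange : Set.range x = vertices P)
    {g g' : Gens w} (hpos : ∀ a, genVec w g a ≠ 0 ↔ 0 < r a)
    (hneg : ∀ a, genVec w g' a ≠ 0 → r a < 0) : False := by
  have hne : g' ≠ g := by
    rintro rfl
    obtain ⟨a, ha⟩ := genVec_ne_zero g'
    exact absurd (hneg a ha) (not_lt_of_gt ((hpos a).1 ha))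
  -- Subtracting δ r keeps the generator g nonnegative and makes it positive on the support of g',
  -- which leaves room for ε g'. After projection x g lies on a segment ending at x g', against
  -- extremality and injectivity.
  obtain ⟨δ, hδ, hδr⟩ : ∃ δ : ℝ, 0 < δ ∧ ∀ a, δ * r a ≤ genVec w g a := by
    obtain ⟨a₀, ha₀⟩ := hr.exists_pos
    obtain ⟨b, hb, hbmin⟩ := Finset.exists_min_image (Finset.univ.filter fun a => 0 < r a)
      (fun a => genVec w g a / r a) ⟨a₀, by simpa using ha₀⟩
    have hb' : 0 < r b := by simpa using hb
    refine ⟨genVec w g b / r b, div_pos ?_ hb', fun a => ?_⟩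
    · exact lt_of_le_of_ne (genVec_nonneg w g b) ((hpos b).2 hb').symm
    · by_cases ha : 0 < r a
      · rw [← le_div_iff₀ ha]
        exact hbmin a (by simpa using ha)
      · exact (mul_nonpos_of_nonneg_of_nonpos
          (div_nonneg (genVec_nonneg w g b) hb'.le) (not_lt.1 ha)).trans (genVec_nonneg w g a)
  obtain ⟨ε, hε, hεr⟩ : ∃ ε : ℝ, 0 < ε ∧ ∀ a, ε * genVec w g' a ≤ genVec w g a - δ * r a := by
    obtain ⟨a₀, ha₀⟩ := genVec_ne_zero g'
    obtain ⟨b, hb, hbmin⟩ := Finset.exists_min_image (Finset.univ.filter fun a => genVec w g' a ≠ 0)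
      (fun a => (genVec w g a - δ * r a) / genVec w g' a) ⟨a₀, by simpa using ha₀⟩
    have hb' : genVec w g' b ≠ 0 := by simpa using hb
    have hgp : ∀ a, genVec w g' a ≠ 0 → 0 < genVec w g' a := fun a ha =>
      lt_of_le_of_ne (genVec_nonneg w g' a) ha.symm
    refine ⟨(genVec w g b - δ * r b) / genVec w g' b, div_pos ?_ (hgp b hb'), fun a => ?_⟩
    · have h1 := mul_neg_of_pos_of_neg hδ (hneg b hb')
      have h2 : 0 ≤ genVec w g b := genVec_nonneg w g b
      linarith
    · by_cases ha : genVec w g' a = 0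
      · rw [ha, mul_zero]
        linarith [hδr a]
      · rw [← le_div_iff₀ (hgp a ha)]
        exact hbmin a (by simpa using ha)
  have hmem : genVec w g - δ • r - ε • genVec w g' ∈ orth w :=
    Submodule.sub_mem _ (Submodule.sub_mem _ (mem_orth.2 (dotProduct_genVec w g))
      (Submodule.smul_mem _ _ (mem_orth.2 h.rel)))
      (Submodule.smul_mem _ _ (mem_orth.2 (dotProduct_genVec w g')))
  obtain ⟨s, hs, y, hy, hρ⟩ := h.rep.mem _ hmem fun a => by
    have := hεr a
    simp only [Pi.zero_apply, Pi.sub_apply, Pi.smul_apply, smul_eq_mul]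
    linarith
  rw [map_sub, map_sub, map_smul, map_smul, h.map_rel, hx.map, hx.map, smul_zero, sub_zero,
    sub_eq_iff_eq_add, smul_smul] at hρ
  have hv : x g ∈ vertices P := hrange ▸ Set.mem_range_self g
  exact hne (hinj (eq_of_mem_vertices hv hy (hx.mem g') hs
    (mul_pos hε (h.scale_pos hx hr g')) hρ))

/-- A failing generator would have a sign class of r as its support. By counting, r then has the
other sign on the three remaining coordinates where w is nonzero, and these support a disjoint
generator, which is impossible. -/
theorem IsProjection.all_survive (h : IsProjection P w r ρ) (hx : IsGenPoints P w ρ x t)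
    (hr : ManySigns r) (hinj : Function.Injective x) (hrange : Set.range x = vertices P)
    (hp : Fintype.card {i // 0 < w i} = 2) (hq : Fintype.card {j // w j < 0} = 3)
    (hzero : ∀ c, w c = 0 → r c = 0) (g : Gens w) : Survives w r g := by
  have key : ∀ r : ι → ℝ, IsProjection P w r ρ → ManySigns r → (∀ c, w c = 0 → r c = 0) →
      ¬ ∀ a, genVec w g a ≠ 0 ↔ 0 < r a := by
    intro r h hr hzero hpos
    have h2 := hr.two_le
    have hpos2 : Fintype.card {i // 0 < r i} = 2 := by
      have h3 := genSupp_card_le g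
      have h4 : genSupp g = Finset.univ.filter fun a => 0 < r a := by
        ext a
        rw [mem_genSupp, hpos]
        simp
      rw [h4, ← Fintype.card_subtype] at h3
      omega
    have hneg3 : 3 ≤ Fintype.card {i // r i < 0} := by
      unfold ManySigns at hr
      rw [hpos2] at hr
      omega
    have hall : ∀ a, w a ≠ 0 → ¬ 0 < r a → r a < 0 := by
      intro a ha hra
      have h5 := card_eq_pos_add_neg_add_zero w
      have h6 := card_eq_pos_add_neg_add_zero r
      have h7 : ∀ c, r c = 0 → w c = 0 := by
        have h8 : Finset.univ.filter (fun c => w c = 0) ⊆ Finset.univ.filter fun c => r c = 0 := by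
          intro c hc
          simp only [Finset.mem_filter, Finset.mem_univ, true_and] at hc ⊢
          exact hzero c hc
        have h9 := Finset.eq_of_subset_of_card_le h8 (by
          rw [← Fintype.card_subtype, ← Fintype.card_subtype]
          omega)
        intro c hc
        have : c ∈ Finset.univ.filter fun c => w c = 0 := by
          rw [h9]
          simpa using hc
        simpa using this
      exact lt_of_le_of_ne (not_lt.1 hra) fun h0 => ha (h7 a h0)
    rcases g with c | ⟨i, j⟩
    · have h3 : Fintype.card {i // 0 < r i} ≤ 1 := by
        refine Fintype.card_le_one_iff.2 fun a b => Subtype.ext ?_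
        rw [genVec_inl_ne_zero.1 ((hpos a).2 a.2), genVec_inl_ne_zero.1 ((hpos b).2 b.2)]
      omega
    · obtain ⟨i', hi'⟩ := Fintype.exists_ne_of_one_lt_card (by omega) i
      obtain ⟨j', hj'⟩ := Fintype.exists_ne_of_one_lt_card (by omega) j
      refine h.false_of_supp_pos hx hr hinj hrange hpos (g' := .inr (i', j')) fun a ha => ?_
      have hnot : ¬ 0 < r a := by
        rw [← hpos, genVec_inr_ne_zero]
        rcases genVec_inr_ne_zero.1 ha with rfl | rfl
        · rintro (h3 | h3)
          · exact hi' (Subtype.ext h3)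
          · have := i'.2
            rw [h3] at this
            exact absurd this (not_lt_of_gt j.2)
        · rintro (h3 | h3)
          · have := j'.2
            rw [h3] at this
            exact absurd this (not_lt_of_gt i.2)
          · exact hj' (Subtype.ext h3)
      refine hall a ?_ hnot
      rcases genVec_inr_ne_zero.1 ha with rfl | rfl
      · exact i'.2.ne'
      · exact j'.2.ne
  by_contra hg
  rcases hr.supp_eq hg with hpos | hpos
  · exact key r h hr hzero hpos
  · exact key (-r) h.neg_right hr.neg (fun c hc => by simp [hzero c hc])
      fun a => by simpa using hpos a

end Classification

/-! ### The hexagonal base and the final case distinction -/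

section DesarguianHexagon

variable {E : Type*} [NormedAddCommGroup E] [NormedSpace ℝ E] [FiniteDimensional ℝ E]
  {ι : Type*} [Fintype ι] [DecidableEq ι] {P : Set E} {w r : ι → ℝ}
  {ρ : (ι → ℝ) →ₗ[ℝ] E × ℝ} {x : Gens w → E} {t : Gens w → ℝ}

/-- The points of `P` from the generators supported on a positive and a negative coordinate. -/
def pairPoint {κ μ : Type*} (x : Gens w → E) (e : κ ≃ {i // 0 < w i}) (f : μ ≃ {j // w j < 0})
    (ij : κ × μ) : E := x (.inr (e ij.1, f ij.2))

/-- The positive and negative coordinates. -/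
def coordLabel {κ μ : Type*} (e : κ ≃ {i // 0 < w i}) (f : μ ≃ {j // w j < 0}) : κ ⊕ μ → ι :=
  Sum.elim (fun i => e i) (fun j => f j)

theorem genVec_coordLabel {κ μ : Type*} (e : κ ≃ {i // 0 < w i}) (f : μ ≃ {j // w j < 0})
    (s : κ ⊕ μ) (ij : κ × μ) : genVec w (.inr (e ij.1, f ij.2)) (coordLabel e f s) ≠ 0 ↔
      s = .inl ij.1 ∨ s = .inr ij.2 := by
  have h1 : ∀ i j, (e i : ι) ≠ f j := fun i j heq => by
    have h2 := (e i).2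
    rw [heq] at h2
    exact absurd h2 (not_lt_of_gt (f j).2)
  rw [genVec_inr_ne_zero]
  rcases s with i | j
  · simp [coordLabel, h1, ← Subtype.ext_iff]
  · simp [coordLabel, (h1 _ _).symm, ← Subtype.ext_iff]

/-- A positive and a negative coordinate of r give a functional −r b z a + r a z b that descends to
P and vanishes exactly at the generators avoiding both coordinates; `hk` says that two of them do.
-/
theorem IsProjection.segment_mem_faces (h : IsProjection P w r ρ) (hx : IsGenPoints P w ρ x t)
    (hr : ManySigns r) {κ μ : Type*} (e : κ ≃ {i // 0 < w i}) (f : μ ≃ {j // w j < 0})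
    {s s' : κ ⊕ μ} (hs : 0 < r (coordLabel e f s)) (hs' : r (coordLabel e f s') < 0)
    {k k' : κ × μ} (hk : ∀ ij : κ × μ, (¬ (s = .inl ij.1 ∨ s = .inr ij.2) ∧
      ¬ (s' = .inl ij.1 ∨ s' = .inr ij.2)) ↔ (ij = k ∨ ij = k')) :
    segment ℝ (pairPoint x e f k) (pairPoint x e f k') ∈
      faces (convexHull ℝ (Set.range (pairPoint x e f))) := by
  set a := coordLabel e f s
  set b := coordLabel e f s'
  let c := genVec r (.inr (⟨a, hs⟩, ⟨b, hs'⟩))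
  obtain ⟨ψ, hψ⟩ := exists_factor (orth w) ρ (dotLin c) fun z hz h0 => by
    obtain ⟨τ, rfl⟩ := (h.ker z (mem_orth.1 hz)).1 h0
    rw [dotLin_apply, dotProduct_smul, dotProduct_comm, dotProduct_genVec, smul_zero]
  have hval : ∀ ij, t (.inr (e ij.1, f ij.2)) * ψ (hom (pairPoint x e f ij)) =
      -r b * genVec w (.inr (e ij.1, f ij.2)) a + r a * genVec w (.inr (e ij.1, f ij.2)) b := by
    intro ij
    have h1 := hψ _ (mem_orth.2 (dotProduct_genVec w (.inr (e ij.1, f ij.2))))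
    rw [hx.map, map_smul, smul_eq_mul, dotLin_apply] at h1
    rw [pairPoint, h1]
    rw [show c = Pi.single a (-r b) + Pi.single b (r a) from rfl, add_dotProduct,
      single_dotProduct, single_dotProduct]
  have ht : ∀ ij : κ × μ, 0 < t (.inr (e ij.1, f ij.2)) := fun ij => h.scale_pos hx hr _
  have hnn : ∀ ij, 0 ≤ ψ (hom (pairPoint x e f ij)) := by
    intro ij
    refine nonneg_of_mul_nonneg_right (a := t (.inr (e ij.1, f ij.2)))
      (b := ψ (hom (pairPoint x e f ij))) ?_ (ht ij)
    rw [hval]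
    exact add_nonneg (mul_nonneg (neg_nonneg.2 hs'.le) (genVec_nonneg w _ _))
      (mul_nonneg hs.le (genVec_nonneg w _ _))
  have hNN : NonnegOn ψ (Set.range (pairPoint x e f)) := by
    rintro _ ⟨ij, rfl⟩
    exact hnn ij
  refine mem_faces_iff.2 ⟨ψ, hNN.convexHull, ?_⟩
  rw [zeros_convexHull hNN, sep_range, ← convexHull_pair, ← Set.image_pair]
  congr 2
  ext ij
  have h2 : 0 ≤ genVec w (.inr (e ij.1, f ij.2)) a := genVec_nonneg w _ a
  have h3 : 0 ≤ genVec w (.inr (e ij.1, f ij.2)) b := genVec_nonneg w _ b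
  have h4 := (genVec_coordLabel e f s ij).not
  have h5 := (genVec_coordLabel e f s' ij).not
  rw [not_not] at h4 h5
  change (ij = k ∨ ij = k') ↔ ψ (hom (pairPoint x e f ij)) = 0
  rw [← hk, ← h4, ← h5]
  have h6 := hval ij
  constructor
  · rintro ⟨h7, h8⟩
    rw [h7, h8] at h6
    simpa [(ht ij).ne'] using h6
  · intro h7
    rw [h7, mul_zero] at h6
    have h8 := mul_nonneg (neg_nonneg.2 hs'.le) h2
    have h9 := mul_nonneg hs.le h3
    constructor
    · exact (mul_eq_zero.1 (show -r b * _ = 0 by linarith)).resolve_left (neg_ne_zero.2 hs'.ne)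
    · exact (mul_eq_zero.1 (show r a * _ = 0 by linarith)).resolve_left hs.ne'

/-- Since r vanishes where w does, each such coordinate descends to a functional that is nonzero at
its own apex and zero at the base and the other apexes. -/
theorem IsProjection.isPyramid (h : IsProjection P w r ρ) (hx : IsGenPoints P w ρ x t)
    (hr : ManySigns r) (hzero : ∀ c, w c = 0 → r c = 0)
    {κ μ : Type*} (e : κ ≃ {i // 0 < w i}) (f : μ ≃ {j // w j < 0}) :
    IsPyramid (Fintype.card {c // w c = 0}) (convexHull ℝ (Set.range (pairPoint x e f))) P ∧
      Module.finrank ℝ (homSpan P) =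
        Module.finrank ℝ (homSpan (convexHull ℝ (Set.range (pairPoint x e f)))) +
          Fintype.card {c // w c = 0} := by
  have hex : ∀ c : {c // w c = 0}, ∃ ψ : E × ℝ →ₗ[ℝ] ℝ, ∀ z ∈ orth w, ψ (ρ z) = z c := fun c =>
    exists_factor (orth w) ρ (LinearMap.proj (c : ι)) fun z hz h0 => by
      obtain ⟨τ, rfl⟩ := (h.ker z (mem_orth.1 hz)).1 h0
      simp [hzero c c.2]
  choose ψ hψ using hex
  have hval : ∀ c g, t g * ψ c (hom (x g)) = genVec w g c := by
    intro c g
    rw [← hψ c _ (mem_orth.2 (dotProduct_genVec w g)), hx.map, map_smul, smul_eq_mul]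
  have hval0 : ∀ c g, ψ c (hom (x g)) = 0 ↔ genVec w g c = 0 := by
    intro c g
    rw [← hval, mul_eq_zero, or_iff_right (h.scale_pos hx hr g).ne']
  have hunion : Set.range (pairPoint x e f) ∪ (fun c : {c // w c = 0} => x (.inl c)) ''
      (Finset.univ : Finset {c // w c = 0}) = Set.range x := by
    rw [Finset.coe_univ, Set.image_univ]
    apply Set.Subset.antisymm
    · rintro _ (⟨ij, rfl⟩ | ⟨c, rfl⟩)
      · exact ⟨_, rfl⟩
      · exact ⟨_, rfl⟩
    · rintro _ ⟨c | ⟨i, j⟩, rfl⟩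
      · exact Or.inr ⟨c, rfl⟩
      · exact Or.inl ⟨(e.symm i, f.symm j), by simp [pairPoint]⟩
  have key := isPyramid_of_functionals (Set.range (pairPoint x e f))
    (fun c : {c // w c = 0} => x (.inl c)) ψ ?_ ?_ ?_ Finset.univ
  · rw [hunion, ← hx.hull, ← homSpan_convexHull (Set.range x), ← hx.hull, Finset.card_univ,
      ← homSpan_convexHull (Set.range (pairPoint x e f))] at key
    exact key
  · rintro c _ ⟨ij, rfl⟩
    rw [pairPoint, hval0]
    by_contra hne
    rcases genVec_inr_ne_zero.1 hne with h1 | h1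
    · exact (e ij.1).2.ne' (h1 ▸ c.2)
    · exact (f ij.2).2.ne (h1 ▸ c.2)
  · intro c c' hne
    rw [hval0]
    by_contra h1
    exact hne (Subtype.ext (genVec_inl_ne_zero.1 h1))
  · intro c h0
    rw [hval0] at h0
    exact genVec_inl_ne_zero.2 rfl h0

/-- After scaling, the generator of (i, j) is e i / w i + e j / (−w j), so the difference of those
for i = 0 and i = 1 does not depend on j. Its image is the common vector of the three lines. -/
theorem IsGenPoints.concurrent (hx : IsGenPoints P w ρ x t) (ht : ∀ g, 0 < t g)
    (e : Fin 2 ≃ {i // 0 < w i}) (f : Fin 3 ≃ {j // w j < 0}) (σ : Fin 3 → Fin 3) :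
    ConcurrentLines (affineSpan ℝ {pairPoint x e f (0, σ 0), pairPoint x e f (1, σ 0)})
      (affineSpan ℝ {pairPoint x e f (0, σ 1), pairPoint x e f (1, σ 1)})
      (affineSpan ℝ {pairPoint x e f (0, σ 2), pairPoint x e f (1, σ 2)}) := by
  have hw : ∀ i j, 0 < w (e i) * -w (f j) := fun i j => mul_pos (e i).2 (neg_pos.2 (f j).2)
  refine concurrent_of_common_vector
    (a := fun j => pairPoint x e f (0, σ j)) (b := fun j => pairPoint x e f (1, σ j))
    (s := fun j => (w (e 0) * -w (f (σ j)))⁻¹ * t (.inr (e 0, f (σ j))))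
    (t := fun j => (w (e 1) * -w (f (σ j)))⁻¹ * t (.inr (e 1, f (σ j))))
    (X := ρ (Pi.single (e 0 : ι) (w (e 0))⁻¹ - Pi.single (e 1 : ι) (w (e 1))⁻¹))
    (fun j => mul_pos (inv_pos.2 (hw _ _)) (ht _)) fun j => ?_
  simp only [pairPoint]
  rw [mul_smul, mul_smul, ← hx.map, ← hx.map, ← map_smul, ← map_smul, ← map_sub]
  congr 1
  have h0 := (e 0).2.ne'
  have h1 := (e 1).2.ne'
  have h2 := (f (σ j)).2.ne
  have h3 : ∀ (k : ι) (c d : ℝ), c • (Pi.single k d : ι → ℝ) = Pi.single k (c * d) := by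
    intro k c d; rw [← Pi.single_smul]; simp
  simp only [genVec, smul_add, h3]
  have h4 : (w (e 0) * -w (f (σ j)))⁻¹ * -w (f (σ j)) = (w (e 0))⁻¹ := by field_simp
  have h5 : (w (e 1) * -w (f (σ j)))⁻¹ * -w (f (σ j)) = (w (e 1))⁻¹ := by field_simp
  have h6 : (w (e 0) * -w (f (σ j)))⁻¹ * w (e 0) = (-w (f (σ j)))⁻¹ := by field_simp
  have h7 : (w (e 1) * -w (f (σ j)))⁻¹ * w (e 1) = (-w (f (σ j)))⁻¹ := by field_simp
  rw [h4, h5, h6, h7]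
  abel

theorem IsProjection.desarguian_of_signs (h : IsProjection P w r ρ) (hx : IsGenPoints P w ρ x t)
    (hr : ManySigns r) (hinj : Function.Injective x) (hrange : Set.range x = vertices P)
    (hzero : ∀ c, w c = 0 → r c = 0) (hdim : dim P = Fintype.card {c // w c = 0} + 2)
    (e : Fin 2 ≃ {i // 0 < w i}) (f : Fin 3 ≃ {j // w j < 0}) (hα : ∀ i, r (e i) < 0)
    (hβ : r (f 2) < 0) (hβ' : ∀ j, j ≠ 2 → 0 < r (f j)) :
    IsDesarguianHexagon (convexHull ℝ (Set.range (pairPoint x e f))) := by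
  set H := convexHull ℝ (Set.range (pairPoint x e f)) with hH
  have hyinj : Function.Injective (pairPoint x e f) := by
    intro ij ij' heq
    have := hinj heq
    simp only [Sum.inr.injEq, Prod.mk.injEq, e.injective.eq_iff, f.injective.eq_iff] at this
    exact Prod.ext this.1 this.2
  have hHP : H ⊆ P := by
    rw [hx.hull]
    refine convexHull_mono ?_
    rintro _ ⟨ij, rfl⟩
    exact ⟨_, rfl⟩
  have hverts : vertices H = Set.range (pairPoint x e f) := by
    refine Set.Subset.antisymm extremePoints_convexHull_subset ?_
    rintro _ ⟨ij, rfl⟩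
    refine inter_extremePoints_subset_extremePoints_of_subset hHP
      ⟨subset_convexHull _ _ ⟨ij, rfl⟩, ?_⟩
    change _ ∈ vertices P
    rw [← hrange]
    exact ⟨_, rfl⟩
  have hHne : H.Nonempty := ⟨_, subset_convexHull _ _ ⟨(0, 0), rfl⟩⟩
  -- The cyclic order is read off from the six edges, one for each of the two positive and three
  -- negative coordinates of r. The lines p 0 p 1, p 5 p 2, p 3 p 4 belong to the columns j = 0, 2,
  -- 1.
  refine ⟨⟨⟨_, Set.finite_range _, rfl⟩, ?_, ?_⟩, pairPoint x e f ∘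
    ![(0, 0), (1, 0), (1, 2), (1, 1), (0, 1), (0, 2)], ⟨?_, ?_, ?_⟩, ?_⟩
  · have h1 := (h.isPyramid hx hr hzero e f).2
    rw [finrank_homSpan (hHne.mono hHP), finrank_homSpan hHne] at h1
    omega
  · rw [hverts, Set.ncard_range_of_injective hyinj]
    simp
  · exact hyinj.comp (by decide)
  · rw [hverts]
    refine Function.Surjective.range_comp ?_ _
    decide
  · have h0 : 0 < r (coordLabel e f (.inr 0)) := hβ' 0 (by decide)
    have h1 : 0 < r (coordLabel e f (.inr 1)) := hβ' 1 (by decide)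
    have h2 : r (coordLabel e f (.inr 2)) < 0 := hβ
    have ha : ∀ i, r (coordLabel e f (.inl i)) < 0 := hα
    intro k
    fin_cases k
    · exact h.segment_mem_faces hx hr e f h1 h2 (k := (0, 0)) (k' := (1, 0)) (by decide)
    · exact h.segment_mem_faces hx hr e f h1 (ha 0) (k := (1, 0)) (k' := (1, 2)) (by decide)
    · exact h.segment_mem_faces hx hr e f h0 (ha 0) (k := (1, 2)) (k' := (1, 1)) (by decide)
    · exact h.segment_mem_faces hx hr e f h0 h2 (k := (1, 1)) (k' := (0, 1)) (by decide)
    · exact h.segment_mem_faces hx hr e f h0 (ha 1) (k := (0, 1)) (k' := (0, 2)) (by decide)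
    · exact h.segment_mem_faces hx hr e f h1 (ha 1) (k := (0, 2)) (k' := (0, 0)) (by decide)
  · have := hx.concurrent (h.scale_pos hx hr) e f ![0, 2, 1]
    rw [Set.pair_comm (pairPoint x e f (0, ![0, 2, 1] 2))] at this
    exact this

theorem IsProjection.exists_desarguian (h : IsProjection P w r ρ) (hx : IsGenPoints P w ρ x t)
    (hr : ManySigns r) (hinj : Function.Injective x) (hrange : Set.range x = vertices P)
    (hp : Fintype.card {i // 0 < w i} = 2) (hq : Fintype.card {j // w j < 0} = 3)
    (hzero : ∀ c, w c = 0 → r c = 0) (hdim : dim P = Fintype.card {c // w c = 0} + 2) :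
    ∃ H : Set E, IsDesarguianHexagon H ∧ IsPyramid (dim P - 2) H P := by
  let e := (Fintype.equivFinOfCardEq hp).symm
  let f := (Fintype.equivFinOfCardEq hq).symm
  have hsum : ∑ i, w (e i) * r (e i) = ∑ j, -w (f j) * r (f j) := by
    have h1 := h.rel
    rw [dotProduct_eq_pos_sub_neg, sub_eq_zero] at h1
    rw [e.sum_comp fun i : {i // 0 < w i} => w i * r i, h1,
      f.sum_comp fun j : {j // w j < 0} => -w j * r j]
  have hcases : ∀ (p : ι → Prop), (∀ c, w c = 0 → ¬ p c) → ∀ i j,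
      (∃ a, genVec w (.inr (e i, f j)) a = 0 ∧ p a) →
      (∃ i', i' ≠ i ∧ p (e i')) ∨ ∃ j', j' ≠ j ∧ p (f j') := by
    rintro p hp0 i j ⟨a, ha, hpa⟩
    have hne : ¬ (a = e i ∨ a = f j) := by
      rw [← genVec_inr_ne_zero (i := e i) (j := f j)]
      exact not_not.2 ha
    push Not at hne
    rcases lt_trichotomy (w a) 0 with hw | hw | hw
    · right
      refine ⟨f.symm ⟨a, hw⟩, fun heq => hne.2 ?_, by simpa using hpa⟩
      rw [← heq, Equiv.apply_symm_apply]
    · exact absurd hpa (hp0 a hw)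
    · left
      refine ⟨e.symm ⟨a, hw⟩, fun heq => hne.1 ?_, by simpa using hpa⟩
      rw [← heq, Equiv.apply_symm_apply]
  have hsurv := h.all_survive hx hr hinj hrange hp hq hzero
  have hsigns := hexagon_signs (α := fun i => r (e i)) (β := fun j => r (f j))
    (u := fun i => w (e i)) (v := fun j => -w (f j)) (fun i => (e i).2)
    (fun j => neg_pos.2 (f j).2) hsum
    (fun i j => hcases (fun a => 0 < r a) (fun c hc => by simp [hzero c hc]) i j
      (hsurv (.inr (e i, f j))).1)
    (fun i j => hcases (fun a => r a < 0) (fun c hc => by simp [hzero c hc]) i j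
      (hsurv (.inr (e i, f j))).2)
  have hpyr : ∀ f' : Fin 3 ≃ {j // w j < 0},
      IsPyramid (dim P - 2) (convexHull ℝ (Set.range (pairPoint x e f'))) P := by
    intro f'
    rw [hdim, Nat.add_sub_cancel]
    exact (h.isPyramid hx hr hzero e f').1
  have hswap : ∀ j₂ j : Fin 3, j ≠ 2 → Equiv.swap j₂ 2 j ≠ j₂ := by decide
  rcases hsigns with ⟨h1, j₂, h2, h3⟩ | ⟨h1, j₂, h2, h3⟩
  · refine ⟨_, h.desarguian_of_signs hx hr hinj hrange hzero hdim e
      ((Equiv.swap j₂ 2).trans f) h1 ?_ ?_, hpyr _⟩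
    · simpa using h2
    · exact fun j hj => h3 _ (hswap j₂ j hj)
  · refine ⟨_, h.neg_right.desarguian_of_signs hx hr.neg hinj hrange
      (fun c hc => by simp [hzero c hc]) hdim e
      ((Equiv.swap j₂ 2).trans f) (fun i => by simpa using h1 i) ?_ ?_, hpyr _⟩
    · simpa using h2
    · exact fun j hj => by simpa using h3 _ (hswap j₂ j hj)

theorem IsProjection.classification_of_two (h : IsProjection P w r ρ) (hr : ManySigns r)
    (hp : Fintype.card {i // 0 < w i} = 2)
    (hq : Fintype.card {j // w j < 0} = 3 ∨ Fintype.card {j // w j < 0} = 4)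
    (hv : (vertices P).ncard = Fintype.card ι + 1) (hdim : Fintype.card ι = dim P + 3) :
    (∃ H : Set E, IsDesarguianHexagon H ∧ IsPyramid (dim P - 2) H P) ∨
      ∃ S : Set E, S ⊆ vertices P ∧ S.ncard = 6 ∧ IsTriangularPrism (convexHull ℝ S) := by
  rcases hq with hq | hq
  · obtain ⟨x, t, hx⟩ := h.exists_genPoints
    have h1 := card_gens w
    have h2 := card_eq_pos_add_neg_add_zero w
    rw [hp, hq] at h1 h2
    obtain ⟨hinj, hrange⟩ := hx.bijective (by omega)
    by_cases hzero : ∀ c, w c = 0 → r c = 0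
    · exact Or.inl (h.exists_desarguian hx hr hinj hrange hp hq hzero (by omega))
    · push Not at hzero
      obtain ⟨c, hc, hrc⟩ := hzero
      let e := (Fintype.equivFinOfCardEq hp).symm
      let f := (Fintype.equivFinOfCardEq hq).symm
      refine Or.inr (h.prism_of_injective hx hr e f e.injective f.injective hrc
        (fun i heq => (e i).2.ne' (heq ▸ hc)) (fun j heq => (f j).2.ne (heq ▸ hc))
        (fun i j => hrange ▸ Set.mem_range_self _) fun i j i' j' heq => hinj heq)
  · exact Or.inr (h.prism_of_four hr hp hq hv)

/-- The bounds k + 1 ≤ z + pq ≤ k + 2 leave four sign counts for w; replacing w by −w arranges that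
the smaller class is the positive one. -/
theorem IsProjection.classification (h : IsProjection P w r ρ)
    (hv : (vertices P).ncard = Fintype.card ι + 1)
    (hf : Fintype.card ι + 1 ≤ (facets P).ncard) (hdim : Fintype.card ι = dim P + 3) :
    (∃ H : Set E, IsDesarguianHexagon H ∧ IsPyramid (dim P - 2) H P) ∨
      ∃ S : Set E, S ⊆ vertices P ∧ S.ncard = 6 ∧ IsTriangularPrism (convexHull ℝ S) := by
  have hr : ManySigns r := h.sign_count hf
  obtain ⟨x, t, hx⟩ := h.exists_genPoints
  have h1 := (h.le_vertices hx hr).1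
  have h2 := IsProjection.vertices_le hx
  have h3 := card_gens w
  have h4 := card_eq_pos_add_neg_add_zero w
  rcases product_cases (p := Fintype.card {i // 0 < w i}) (q := Fintype.card {j // w j < 0})
    (by omega) (by omega) with ⟨hp, hq⟩ | ⟨hq, hp⟩
  · exact h.classification_of_two hr hp hq hv hdim
  · have h5 : Fintype.card {i // 0 < (-w) i} = Fintype.card {i // w i < 0} :=
      Fintype.card_congr (Equiv.subtypeEquivRight fun i => by simp)
    have h6 : Fintype.card {i // (-w) i < 0} = Fintype.card {i // 0 < w i} :=
      Fintype.card_congr (Equiv.subtypeEquivRight fun i => by simp)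
    exact h.neg_left.classification_of_two hr (by omega) (by omega) hv hdim

end DesarguianHexagon

end PolyXC

theorem mainTheorem6 (n d : ℕ) (P : Set (EuclideanSpace ℝ (Fin n)))
    (hP : PolyXC.IsPolytope P) (hdim : PolyXC.dim P = d)
    (hvert : (PolyXC.vertices P).ncard = d + 4)
    (hfacets : d + 4 ≤ (PolyXC.facets P).ncard) :
    PolyXC.xc P = d + 3 ↔
      (∃ H : Set (EuclideanSpace ℝ (Fin n)),
        PolyXC.IsDesarguianHexagon H ∧ PolyXC.IsPyramid (d - 2) H P) ∨
      (∃ S : Set (EuclideanSpace ℝ (Fin n)), S ⊆ PolyXC.vertices P ∧ S.ncard = 6 ∧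
        PolyXC.IsTriangularPrism (convexHull ℝ S)) := by
  subst hdim
  have hfin := hP.finite_vertices
  have hone : 1 < (PolyXC.vertices P).ncard := by omega
  have hnt : P.Nontrivial :=
    (Set.one_lt_ncard_iff_nontrivial_and_finite.1 hone).1.mono fun x hx => hx.1
  obtain ⟨hlow, hproj⟩ := PolyXC.xc_lower hP hnt hvert.ge hfacets
  constructor
  · intro hxc
    obtain ⟨w, r, ρ, h⟩ := hproj hxc
    exact h.classification (by rw [Fintype.card_fin]; omega) (by rw [Fintype.card_fin]; omega)
      (Fintype.card_fin _)
  · rintro (⟨H, hH, hpyr⟩ | ⟨S, hS, hcard, hprism⟩)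
    · have hone : 1 < (PolyXC.vertices H).ncard := by rw [hH.1.2.2]; omega
      have hHnt : H.Nontrivial :=
        (Set.one_lt_ncard_iff_nontrivial_and_finite.1 hone).1.mono fun x hx => hx.1
      have h1 := (PolyXC.IsPyramid.xc_le hH.1.1 hHnt hpyr).2.2
      have h2 := hH.xc_le
      -- For d < 2 the subtraction d − 2 truncates to 0, so P would itself be a hexagon, of
      -- dimension 2.
      by_cases hd : 2 ≤ PolyXC.dim P
      · omega
      · rw [show PolyXC.dim P - 2 = 0 by omega] at hpyr
        obtain rfl : P = H := hpyr
        have := hH.1.2.1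
        omega
    · have := PolyXC.xc_le_of_prism hP hS hcard hprism
      omega
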